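/- Let $K$ be an algebraically closed field, let $1\le c\le N$ be integers and let $2\le d_1\le\dots\le d_c$ be integers. A *weight* is a tuple $\alpha=(\alpha_0,\dots,\alpha_N)$ of integers $\alpha_0\le\dots\le\alpha_N$, not all zero, with $\sum_i\alpha_i=0$. For a nonzero polynomial $F\in K[X_0,\dots,X_N]$, let $\deg_\alpha(F)$ be the largest value of $\sum_i\alpha_i\lambda_i$ over the monomials $X_0^{\lambda_0}\cdots X_N^{\lambda_N}$ that occur in $F$. We say that homogeneous polynomials $F_1,\dots,F_c\in K[X_0,\dots,X_N]$ of degrees $d_1,\dots,d_c$ *define a smooth complete intersection* if the subscheme $\{F_1=\dots=F_c=0\}$ of $\mathbb{P}^N_K$ has codimension $c$ and is smooth over $K$ (the $F_i$ are then nonzero). For real numbers $k_1,\dots,k_c$ consider $$(1)\quad \min_{1\le i\le c}k_i\ \ge\ \frac{1}{N+1}\sum_{i=1}^c k_i,\qquad\qquad (2)\quad \sum_{i=1}^c k_i\,\frac{\deg_\alpha(F_i)}{d_i}\ \ge\ 0 .$$ (i) If $k_1,\dots,k_c$ satisfy (1), then (2) holds for every weight $\alpha$ and all $F_1,\dots,F_c$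 of degrees $d_1,\dots,d_c$ defining a smooth complete intersection. (ii) Suppose that we do not have $c=1$ and $d_1=2$. If $k_1,\dots,k_c$ satisfy (1) with strict inequality, then (2) holds with strict inequality for every weight $\alpha$ and all $F_1,\dots,F_c$ of degrees $d_1,\dots,d_c$ defining a smooth complete intersection. (iii) Both statements are optimal. If real numbers $k_1,\dots,k_c$ do not satisfy (1), there are a weight $\alpha$ and equations $F_1,\dots,F_c$ of degrees $d_1,\dots,d_c$ defining a smooth complete intersection for which (2) fails. If $k_1,\dots,k_c$ do not satisfy (1) with strict inequality, there are a weight $\alpha$ and such equations $F_1,\dots,F_c$ for which (2) with strict inequality fails. Moreover the case excluded in (ii) has to be excluded: if $c=1$ and $d_1=2$, then for every real $k_1$ there are a weight $\alpha$ and an equation $F_1$ of degree $2$ defining a smooth quadric for which (2) with strict inequality fails. -/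

import Mathlib

namespace AlphaDegree

open MvPolynomial

/-- The affine coordinate ring of the chart `X_j ≠ 0` of the closed subscheme
`{F_1 = ⋯ = F_c = 0}` of `ℙ^N_K`: the ring `K[X_0, …, X_N] / (F_1, …, F_c, X_j - 1)`, i.e. the
quotient of `K[X_0, …, X_N]/(X_j - 1)`, the polynomial ring in the affine coordinates of the chart,
by the dehomogenized equations. -/
abbrev ChartRing {K : Type*} [Field K] {N c : ℕ}
    (F : Fin c → MvPolynomial (Fin (N + 1)) K) (j : Fin (N + 1)) : Type _ :=
  MvPolynomial (Fin (N + 1)) K ⧸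
    (Ideal.span (Set.range F) ⊔ Ideal.span {(X j - 1 : MvPolynomial (Fin (N + 1)) K)})

/-- `F_1, …, F_c` are homogeneous equations of degrees `d_1, …, d_c` that define a smooth complete
intersection in `ℙ^N_K`: the subscheme `{F_1 = ⋯ = F_c = 0}` has codimension `c`, and it is smooth
over `K`. -/
structure IsSmoothCompleteIntersection {K : Type*} [Field K] {N c : ℕ} (d : Fin c → ℕ)
    (F : Fin c → MvPolynomial (Fin (N + 1)) K) : Prop where
  /-- `F_i` is a section of `𝒪(d_i)`. -/
  isHomogeneous : ∀ i, (F i).IsHomogeneous (d i)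
  /-- The codimension of the subscheme (equivalently, of its affine cone) is `c`. -/
  height_eq : (Ideal.span (Set.range F)).height = c
  /-- The subscheme is smooth over `K`, on each of the standard charts that cover it. -/
  smooth : ∀ j, Algebra.Smooth K (ChartRing F j)

/-- `α_0 ≤ ⋯ ≤ α_N` are integers, not all zero, whose sum is zero. -/
structure IsWeight {N : ℕ} (α : Fin (N + 1) → ℤ) : Prop where
  monotone : Monotone α
  ne_zero : ∃ i, α i ≠ 0
  sum_eq_zero : ∑ i, α i = 0

/-- The `α`-degree of a polynomial, the largest value of `∑ i, α i * m i` over the monomials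
`X ^ m` that occur in it. The value `-∞` of the zero polynomial is replaced by `0`; this is never
used, by `IsSmoothCompleteIntersection.ne_zero`. -/
noncomputable def alphaDeg {K : Type*} [Field K] {N : ℕ} (α : Fin (N + 1) → ℤ)
    (F : MvPolynomial (Fin (N + 1)) K) : ℤ :=
  (weightedTotalDegree' α F).unbotD 0

/-- The sum `∑ i, k_i deg_α(F_i) / d_i`. -/
noncomputable def weightedDegSum {K : Type*} [Field K] {N c : ℕ} (d : Fin c → ℕ) (k : Fin c → ℝ)
    (α : Fin (N + 1) → ℤ) (F : Fin c → MvPolynomial (Fin (N + 1)) K) : ℝ :=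
  ∑ i, k i * ((alphaDeg α (F i) : ℝ) / (d i : ℝ))

/-- None of the equations of a smooth complete intersection is zero. -/
theorem IsSmoothCompleteIntersection.ne_zero {K : Type*} [Field K] {N c : ℕ} {d : Fin c → ℕ}
    {F : Fin c → MvPolynomial (Fin (N + 1)) K} (h : IsSmoothCompleteIntersection d F)
    (i : Fin c) : F i ≠ 0 := by
  classical
  intro h0
  set s : Finset (MvPolynomial (Fin (N + 1)) K) := (Finset.univ.erase i).image F with hs
  have hspan : Ideal.span (Set.range F) = Ideal.span (s : Set (MvPolynomial (Fin (N + 1)) K)) := by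
    apply le_antisymm
    · rw [Ideal.span_le]
      rintro _ ⟨j, rfl⟩
      by_cases hj : j = i
      · subst hj
        rw [h0]
        exact Ideal.zero_mem _
      · exact Ideal.subset_span (by simp only [hs, Finset.coe_image]; exact ⟨j, by simp [hj], rfl⟩)
    · apply Ideal.span_mono
      intro x hx
      simp only [hs, Finset.coe_image] at hx
      obtain ⟨j, -, rfl⟩ := hx
      exact ⟨j, rfl⟩
  have hI := h.height_eq
  have hne : Ideal.span (Set.range F) ≠ ⊤ := by
    intro ht
    rw [ht, Ideal.height_top] at hI
    exact absurd hI.symm (ENat.natCast_ne_top c)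
  obtain ⟨p, hp⟩ := Ideal.nonempty_minimalPrimes hne
  have hprime : p.IsPrime := hp.1.1
  have h1 : (Ideal.span (Set.range F)).height ≤ p.height := Ideal.height_mono hp.1.2
  rw [hspan] at hp
  have h2 := Ideal.height_le_card_of_mem_minimalPrimes_span_finset hp
  have h3 : s.card ≤ c - 1 := by
    refine Finset.card_image_le.trans ?_
    simp
  rw [hI] at h1
  have h4 : (c : ℕ∞) ≤ ((c - 1 : ℕ) : ℕ∞) := (h1.trans h2).trans (by exact_mod_cast h3)
  have h5 : c ≤ c - 1 := by exact_mod_cast h4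
  have := i.pos
  omega

end AlphaDegree

namespace AlphaDegree

open MvPolynomial

/-! Smoothness is used only through `IsNondegenerate`: at every nonzero point of the affine cone the
gradients of the `F i` are linearly independent. `IsSmoothCompleteIntersection.isNondegenerate` and
`IsNondegenerate.isSmoothCompleteIntersection` translate in both directions.

Put `y j = deg_α (F j) / d j` and fix a threshold `t`. On the linear space where `x i = 0` for all
`α i < t`, the equations with `y j < t` vanish identically, and so do the partial derivatives of `F
k` in the directions `l` with `α l > deg_α (F k) - (d k - 1) t`. If the remaining equations and
derivatives were fewer than the dimension of this space, they would have a nonzero common zero,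
where the gradient of `F k` vanishes. This gives the count `card_filter_le_of_alphaDeg_lt`.
Integrating it over `t > y k`, for `k` of minimal slope, and using `∑ α i = 0` yields
`sum_slope_nonneg`: `0 ≤ ∑ (y j - y k) + (N + 1) y k`. The sum in (2) is a combination of this
quantity and of the differences `y j - y k`, with coefficients that are nonnegative by (1)
(`sum_mul_eq`).

Under strict (1), equality would force every `deg_α (F j)` to vanish. The integrated count then
makes all `d j` equal to `2`; with at least two quadrics, a singular member of a pencil of square
matrices contradicts nondegeneracy (`exists_alphaDeg_ne_zero`).

For optimality, take the weight `(-1, …, -1, N)` and a system in which only `F i₀` involves the last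
variable, and contains its `d i₀`-th power. The slopes are `N` and `-1`, so the sum is `(N + 1) k i₀
- ∑ k j`. Such nondegenerate systems exist, in every characteristic, by a parameter count
(`exists_isNondegenerate`). The excluded case is witnessed by an antidiagonal quadric. -/

/-! ### Lower bounds for heights from the Jacobian matrix -/

theorem pderiv_mem_of_mem_sq {R σ : Type*} [CommRing R] {q : Ideal (MvPolynomial σ R)}
    {p : MvPolynomial σ R} (hp : p ∈ q ^ 2) (l : σ) : pderiv l p ∈ q := by
  rw [pow_two] at hp
  refine Submodule.mul_induction_on hp (fun a ha b hb => ?_) fun a b ha hb => ?_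
  · rw [Derivation.leibniz, smul_eq_mul, smul_eq_mul]
    exact q.add_mem (q.mul_mem_right _ ha) (q.mul_mem_right _ hb)
  · rw [map_add]
    exact q.add_mem ha hb

/-- Full row rank at one `K`-point gives a right inverse `B` over `K` there; `det (J * B)`
specializes to `1`, hence is nonzero in the domain `A`. -/
theorem eq_zero_of_vecMul_jacobian_eq_zero {K σ ι A : Type*} [Field K] [Fintype σ] [Fintype ι]
    [CommRing A] [IsDomain A] [Algebra K A] (φ : A →ₐ[K] K) (J : Matrix ι σ A)
    (hJ : ∀ v : ι → K, Matrix.vecMul v (J.map φ) = 0 → v = 0) (w : ι → A)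
    (hw : Matrix.vecMul w J = 0) : w = 0 := by
  classical
  obtain ⟨g, hg⟩ := (Matrix.vecMulLinear (J.map φ)).exists_leftInverse_of_injective
    (LinearMap.ker_eq_bot'.2 hJ)
  let B : Matrix σ ι K := fun l i => g (fun j => if l = j then 1 else 0) i
  have hB : J.map φ * B = 1 := by
    ext i k
    have h1 := congrFun (LinearMap.congr_fun hg (Pi.single i 1)) k
    rw [LinearMap.comp_apply, Matrix.vecMulLinear_apply, Matrix.single_one_vecMul,
      LinearMap.pi_apply_eq_sum_univ g] at h1
    simp only [LinearMap.id_apply, Finset.sum_apply, Pi.smul_apply, smul_eq_mul] at h1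
    rw [Matrix.one_apply, eq_comm, Matrix.mul_apply]
    rw [Pi.single_apply] at h1
    simp only [eq_comm (a := k)] at h1
    exact h1.symm
  have hdet : (J * B.map (algebraMap K A)).det ≠ 0 := by
    intro h0
    have h1 := congrArg φ h0
    rw [AlgHom.map_det] at h1
    have h2 : φ.mapMatrix (J * B.map (algebraMap K A)) = 1 := by
      rw [AlgHom.mapMatrix_apply, Matrix.map_mul, ← hB]
      congr 1
      ext i k
      simp
    rw [h2] at h1
    simp at h1
  apply Matrix.eq_zero_of_vecMul_eq_zero hdet
  rw [← Matrix.vecMul_vecMul, hw, Matrix.zero_vecMul]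

theorem sum_mul_mem_maximalIdeal_sq {R ι : Type*} [CommRing R] [IsLocalRing R] [Fintype ι]
    (f : ι → IsLocalRing.maximalIdeal R) (g : ι → IsLocalRing.ResidueField R)
    (hg : ∑ i, g i • (IsLocalRing.maximalIdeal R).toCotangent (f i) = 0) (a : ι → R)
    (b : IsLocalRing.ResidueField R) (hag : ∀ i, IsLocalRing.residue R (a i) = b * g i) :
    ∑ i, a i * (f i : R) ∈ IsLocalRing.maximalIdeal R ^ 2 := by
  have h1 : ∑ i, a i • (IsLocalRing.maximalIdeal R).toCotangent (f i) = 0 := by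
    calc ∑ i, a i • (IsLocalRing.maximalIdeal R).toCotangent (f i)
        = ∑ i, IsLocalRing.residue R (a i) • (IsLocalRing.maximalIdeal R).toCotangent (f i) := rfl
      _ = b • ∑ i, g i • (IsLocalRing.maximalIdeal R).toCotangent (f i) := by
        rw [Finset.smul_sum]
        exact Finset.sum_congr rfl fun i _ => by rw [hag i, mul_smul]
      _ = 0 := by rw [hg, smul_zero]
  simp only [← map_smul, ← map_sum] at h1
  simpa using (Ideal.toCotangent_eq_zero _ _).1 h1

/-- The local ring at `q` is regular, so it suffices that the `F i` are independent in its cotangent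
space. Clearing denominators, a relation becomes `s * ∑ a i * F i ∈ q ^ 2` with `s ∉ q`;
differentiating it gives a relation between the rows of the Jacobian matrix over the domain
`MvPolynomial σ K ⧸ q`, which is trivial by its rank at `x`. -/
theorem card_le_height_of_jacobian {K σ ι : Type*} [Field K] [Fintype σ] [Fintype ι]
    (F : ι → MvPolynomial σ K) (q : Ideal (MvPolynomial σ K)) [q.IsPrime] (hF : ∀ i, F i ∈ q)
    (x : σ → K) (hx : ∀ p ∈ q, eval x p = 0)
    (hJ : ∀ v : ι → K, (∀ l, ∑ i, v i * eval x (pderiv l (F i)) = 0) → v = 0) :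
    (Fintype.card ι : ℕ∞) ≤ q.height := by
  classical
  let R := Localization.AtPrime q
  have hreg : IsRegularLocalRing R := inferInstance
  have hdim := (IsRegularLocalRing.iff_finrank_cotangentSpace R).1 hreg
  rw [IsLocalization.AtPrime.ringKrullDim_eq_height q R] at hdim
  have hmem : ∀ i, algebraMap _ R (F i) ∈ IsLocalRing.maximalIdeal R := fun i =>
    (IsLocalization.AtPrime.to_map_mem_maximal_iff R q _).2 (hF i)
  let v : ι → IsLocalRing.CotangentSpace R := fun i =>
    (IsLocalRing.maximalIdeal R).toCotangent ⟨_, hmem i⟩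
  have hli : LinearIndependent (IsLocalRing.ResidueField R) v := by
    rw [Fintype.linearIndependent_iff]
    intro g hg
    obtain ⟨b, hb⟩ := IsLocalization.exist_integer_multiples_of_finite
      (nonZeroDivisors (MvPolynomial σ K ⧸ q)) (S := q.ResidueField) g
    choose a' ha' using hb
    choose a ha using fun i => Ideal.Quotient.mk_surjective (a' i)
    have hb0 : algebraMap (MvPolynomial σ K ⧸ q) q.ResidueField b ≠ 0 := by
      exact IsLocalization.to_map_ne_zero_of_mem_nonZeroDivisors _ le_rfl b.2
    have hag : ∀ i, IsLocalRing.residue R (algebraMap _ R (a i)) =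
        algebraMap (MvPolynomial σ K ⧸ q) q.ResidueField b * g i := by
      intro i
      have h1 := ha' i
      rw [← ha i, Algebra.smul_def] at h1
      exact h1
    have hsum : ∑ i, algebraMap _ R (a i) * algebraMap _ R (F i) ∈
        IsLocalRing.maximalIdeal R ^ 2 := by
      exact sum_mul_mem_maximalIdeal_sq _ _ hg _ _ hag
    obtain ⟨s, hs, hsq⟩ : ∃ s ∉ q, s * ∑ i, a i * F i ∈ q ^ 2 := by
      rw [← Localization.AtPrime.map_eq_maximalIdeal, ← Ideal.map_pow] at hsum
      simp only [← map_mul, ← map_sum] at hsum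
      obtain ⟨s, hs, h⟩ := (IsLocalization.algebraMap_mem_map_algebraMap_iff q.primeCompl R _ _).1
        hsum
      exact ⟨s, hs, h⟩
    have hw : (fun i => Ideal.Quotient.mk q (s * a i)) = 0 := by
      let φ : (MvPolynomial σ K ⧸ q) →ₐ[K] K := Ideal.Quotient.liftₐ q (aeval x) (by
        intro p hp
        exact hx p hp)
      apply eq_zero_of_vecMul_jacobian_eq_zero φ
        (fun i l => Ideal.Quotient.mk q (pderiv l (F i)))
      · intro v hv
        apply hJ
        intro l
        exact congrFun hv l
      · ext l
        have h1 := pderiv_mem_of_mem_sq hsq l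
        rw [Finset.mul_sum, map_sum] at h1
        have h2 := (Ideal.Quotient.eq_zero_iff_mem).2 h1
        rw [map_sum] at h2
        rw [Pi.zero_apply, ← h2]
        refine Finset.sum_congr rfl fun i _ => ?_
        rw [← mul_assoc, Derivation.leibniz, smul_eq_mul, smul_eq_mul, map_add, map_mul, map_mul,
          map_mul, Ideal.Quotient.eq_zero_iff_mem.2 (hF i)]
        simp
    intro i
    have h1 := Ideal.Quotient.eq_zero_iff_mem.1 (congrFun hw i)
    have h2 : a i ∈ q := (Ideal.IsPrime.mem_or_mem ‹_› h1).resolve_left hs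
    have h3 := hag i
    rw [(IsLocalRing.residue_eq_zero_iff _).2
      ((IsLocalization.AtPrime.to_map_mem_maximal_iff R q _).2 h2)] at h3
    exact (mul_eq_zero.1 h3.symm).resolve_left hb0
  have := hli.fintype_card_le_finrank
  have h4 : ((Fintype.card ι : ℕ∞) : WithBot ℕ∞) ≤ q.height := by
    rw [← hdim]; exact_mod_cast this
  exact_mod_cast h4

theorem card_le_height_of_vanishingIdeal_le {K σ : Type*} [Field K] [IsAlgClosed K] [Fintype σ]
    (q : Ideal (MvPolynomial σ K)) [hq : q.IsPrime] (h : vanishingIdeal K ({0} : Set (σ → K)) ≤ q) :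
    (Fintype.card σ : ℕ∞) ≤ q.height := by
  classical
  have hm : (vanishingIdeal K ({0} : Set (σ → K))).IsMaximal :=
    isMaximal_iff_eq_vanishingIdeal_singleton.2 ⟨0, rfl⟩
  obtain rfl := hm.eq_of_le hq.ne_top h
  refine card_le_height_of_jacobian (fun i => X i) _
    (fun i => (mem_vanishingIdeal_singleton_iff _ _).2 (by simp)) 0
    (fun p hp => (mem_vanishingIdeal_singleton_iff _ _).1 hp) fun v hv => funext fun l => ?_
  have := hv l
  simpa [pderiv_X, Pi.single_apply, apply_ite] using this

/-- Polynomials without constant term have a nontrivial common zero, if there are fewer of them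
than variables. -/
theorem exists_ne_zero_forall_eval_eq_zero {K σ : Type*} [Field K] [IsAlgClosed K] [Fintype σ]
    (s : Finset (MvPolynomial σ K)) (hs : ∀ p ∈ s, eval 0 p = 0) (hcard : s.card < Fintype.card σ) :
    ∃ x : σ → K, x ≠ 0 ∧ ∀ p ∈ s, eval x p = 0 := by
  classical
  by_contra! hcon
  let m := vanishingIdeal K ({0} : Set (σ → K))
  have hm : m.IsMaximal := isMaximal_iff_eq_vanishingIdeal_singleton.2 ⟨0, rfl⟩
  have hmem : ∀ p, p ∈ m ↔ eval 0 p = 0 := fun p => mem_vanishingIdeal_singleton_iff 0 p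
  have hle : Ideal.span (s : Set (MvPolynomial σ K)) ≤ m :=
    Ideal.span_le.2 fun p hp => (hmem p).2 (hs p hp)
  obtain ⟨q, hq, hqm⟩ := Ideal.exists_minimalPrimes_le hle
  have hqp : q.IsPrime := hq.1.1
  have h1 := Ideal.height_le_card_of_mem_minimalPrimes_span_finset hq
  -- By the Nullstellensatz: the zero locus of `q` contains at most the origin.
  have hqm' : m ≤ q := by
    rw [← IsPrime.vanishingIdeal_zeroLocus (K := K) q]
    refine vanishingIdeal_anti_mono fun x hx => ?_
    by_contra hx0
    obtain ⟨p, hp, hp0⟩ := hcon x hx0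
    exact hp0 (hx p (hq.1.2 (Ideal.subset_span hp)))
  have h2 := card_le_height_of_vanishingIdeal_le q hqm'
  have h3 : Fintype.card σ ≤ s.card := by exact_mod_cast h2.trans h1
  omega

/-! ### From smoothness to independent gradients -/

/-- Taylor's formula at order one. -/
theorem aeval_X_add_sub_mem_sq {R σ : Type*} [CommRing R] [Fintype σ]
    (J : Ideal (MvPolynomial σ R)) (h : σ → MvPolynomial σ R) (hh : ∀ l, h l ∈ J)
    (p : MvPolynomial σ R) :
    aeval (fun l => X l + h l) p - (p + ∑ l, h l * pderiv l p) ∈ J ^ 2 := by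
  classical
  induction p using MvPolynomial.induction_on with
  | C a => simp [algebraMap_eq]
  | add p q hp hq =>
    convert (J ^ 2).add_mem hp hq using 1
    simp only [map_add, mul_add, Finset.sum_add_distrib]
    ring
  | mul_X p k hp =>
    have h1 : ∑ l, h l * pderiv l (p * X k) = X k * ∑ l, h l * pderiv l p + p * h k := by
      simp only [Derivation.leibniz, pderiv_X, smul_eq_mul, mul_add, Finset.sum_add_distrib,
        Finset.mul_sum]
      rw [add_comm]
      congr 1
      · exact Finset.sum_congr rfl fun l _ => by ring
      · rw [Finset.sum_eq_single k]
        · simp [mul_comm]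
        · intro l _ hl
          simp [hl.symm]
        · simp
    have h2 : ∑ l, h l * pderiv l p ∈ J := J.sum_mem fun l _ => J.mul_mem_right _ (hh l)
    rw [h1, map_mul, aeval_X]
    have h3 := (J ^ 2).add_mem ((J ^ 2).mul_mem_right (X k + h k) hp)
      (by rw [pow_two]; exact Ideal.mul_mem_mul (hh k) h2 :
        h k * ∑ l, h l * pderiv l p ∈ J ^ 2)
    convert h3 using 1
    ring

/-- Formal smoothness splits `P ⧸ J ^ 2 → P ⧸ J`, where `P` is the polynomial ring. Lifting the
images of the variables under the section to `y l ∈ X l + J`, one gets `G(y) ∈ J ^ 2` for `G ∈ J`,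
and Taylor's formula expresses `G` through the products `(y l - X l) * pderiv l G` modulo `J ^ 2`.
-/
theorem mem_mul_of_formallySmooth {K σ : Type*} [Field K] [Fintype σ]
    (J m : Ideal (MvPolynomial σ K)) [Algebra.FormallySmooth K (MvPolynomial σ K ⧸ J)]
    (hJm : J ≤ m) (G : MvPolynomial σ K) (hG : G ∈ J) (hd : ∀ l, pderiv l G ∈ m) :
    G ∈ m * J := by
  have hJ2 : J ^ 2 ≤ J := Ideal.pow_le_self two_ne_zero
  let g : (MvPolynomial σ K ⧸ J ^ 2) →ₐ[K] (MvPolynomial σ K ⧸ J) :=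
    Ideal.Quotient.factorₐ K hJ2
  have hgs : Function.Surjective g := Ideal.Quotient.factor_surjective hJ2
  have hker : IsNilpotent (RingHom.ker g) := by
    refine ⟨2, ?_⟩
    have h1 : RingHom.ker g = J.map (Ideal.Quotient.mk (J ^ 2)) :=
      Ideal.Quotient.factor_ker hJ2
    rw [h1, ← Ideal.map_pow, Ideal.map_quotient_self]
    rfl
  let s := Algebra.FormallySmooth.liftOfSurjective (AlgHom.id K _) g hgs hker
  have hs : ∀ y, g (s y) = y := fun y =>
    Algebra.FormallySmooth.liftOfSurjective_apply (AlgHom.id K _) g hgs hker y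
  choose y hy using fun l : σ => Ideal.Quotient.mk_surjective (s (Ideal.Quotient.mk J (X l)))
  have hyJ : ∀ l, y l - X l ∈ J := by
    intro l
    have h1 := hs (Ideal.Quotient.mk J (X l))
    rw [← hy l] at h1
    exact Ideal.Quotient.eq.1 h1
  have hcomp : s.comp (Ideal.Quotient.mkₐ K J) =
      (Ideal.Quotient.mkₐ K (J ^ 2)).comp (aeval fun l => X l + (y l - X l)) := by
    ext l
    simp [hy]
  have h0 : aeval (fun l => X l + (y l - X l)) G ∈ J ^ 2 := by
    have h1 := DFunLike.congr_fun hcomp G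
    simp only [AlgHom.comp_apply, Ideal.Quotient.mkₐ_eq_mk] at h1
    rw [Ideal.Quotient.eq_zero_iff_mem.2 hG, map_zero] at h1
    exact Ideal.Quotient.eq_zero_iff_mem.1 h1.symm
  have h2 := aeval_X_add_sub_mem_sq J _ hyJ G
  have h3 : J ^ 2 ≤ m * J := by
    rw [pow_two]; exact Ideal.mul_mono_left hJm
  have h4 : ∑ l, (y l - X l) * pderiv l G ∈ m * J :=
    Ideal.sum_mem _ fun l _ => by
      exact Ideal.mul_mem_mul_rev (hd l) (hyJ l)
  have h5 := (m * J).sub_mem ((m * J).sub_mem (h3 h0) (h3 h2)) h4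
  convert h5 using 1
  ring

/-- The homogeneous core of `q` is a prime that still contains the `F i` but not `X j - 1`, so it is
strictly smaller than `q`. -/
theorem height_add_one_le_of_isHomogeneous {K σ ι : Type*} [Field K] [Fintype σ]
    {d : ι → ℕ} {F : ι → MvPolynomial σ K} (hF : ∀ i, (F i).IsHomogeneous (d i))
    (q : Ideal (MvPolynomial σ K)) [hq : q.IsPrime] (hFq : ∀ i, F i ∈ q) (j : σ)
    (hj : X j - 1 ∈ q) : (Ideal.span (Set.range F)).height + 1 ≤ q.height := by
  classical
  let _ : GradedAlgebra (homogeneousSubmodule σ K) := MvPolynomial.gradedAlgebra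
  let q₀ := (Ideal.homogeneousCore (homogeneousSubmodule σ K) q).toIdeal
  have : q₀.IsPrime := Ideal.IsPrime.homogeneousCore hq
  have hle : q₀ ≤ q := Ideal.toIdeal_homogeneousCore_le (homogeneousSubmodule σ K) q
  have hlt : q₀ < q := by
    refine lt_of_le_of_ne hle fun heq => ?_
    have h1 : X j - 1 ∈ q₀ := heq ▸ hj
    have h2 := (Ideal.homogeneousCore (homogeneousSubmodule σ K) q).isHomogeneous 0 h1
    -- This component is `-1`.
    have h3 : homogeneousComponent 0 (X j - 1 : MvPolynomial σ K) ∈ q₀ := by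
      rw [← decomposition.decompose'_apply]
      exact h2
    rw [homogeneousComponent_zero] at h3
    refine Ideal.IsPrime.ne_top' (I := q₀) ((Ideal.eq_top_iff_one _).2 ?_)
    simpa using q₀.neg_mem h3
  refine le_trans ?_ (Ideal.height_add_one_le_of_lt_of_isPrime hlt)
  refine add_le_add_left (Ideal.height_mono (Ideal.span_le.2 ?_)) 1
  rintro _ ⟨i, rfl⟩
  exact Ideal.mem_homogeneousCore_of_homogeneous_of_mem ⟨d i, hF i⟩ (hFq i)

/-- A Nakayama argument: near `m`, the generator `F k` is redundant modulo `y` and the other `F i`.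
Krull's height theorem is applied to these `c` remaining generators. -/
theorem exists_isPrime_height_le {R : Type*} [CommRing R] [IsNoetherianRing R] {c : ℕ}
    (F : Fin c → R) (y : R) (m : Ideal R) [m.IsPrime] (hFm : ∀ i, F i ∈ m) (hym : y ∈ m)
    (u : Fin c → R) (k : Fin c) (hk : u k ∉ m)
    (hG : ∑ i, u i * F i ∈ m * (Ideal.span (Set.range F) ⊔ Ideal.span {y})) :
    ∃ q : Ideal R, q.IsPrime ∧ (∀ i, F i ∈ q) ∧ y ∈ q ∧ q.height ≤ c := by
  classical
  rw [Ideal.mul_sup] at hG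
  obtain ⟨w, hw, z, hz, hyz⟩ := Submodule.mem_sup.1 hG
  obtain ⟨a, ha, rfl⟩ := (Submodule.mem_ideal_smul_span_iff_exists_sum m F w).1 hw
  rw [Finsupp.sum_fintype _ _ (by simp)] at hyz
  have hzy : z ∈ Ideal.span {y} := Ideal.mul_le_right hz
  let s : Finset R := insert y ((Finset.univ.erase k).image F)
  have hs : s.card ≤ c := by
    refine (Finset.card_insert_le _ _).trans ?_
    have h1 : ((Finset.univ.erase k).image F).card ≤ c - 1 := Finset.card_image_le.trans (by simp)
    have := k.pos
    omega
  have hle : Ideal.span (s : Set R) ≤ m := by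
    refine Ideal.span_le.2 fun p hp => ?_
    simp only [s, Finset.coe_insert, Finset.coe_image] at hp
    rcases hp with rfl | ⟨i, -, rfl⟩
    · exact hym
    · exact hFm i
  obtain ⟨q, hq, hqm⟩ := Ideal.exists_minimalPrimes_le hle
  have hqp : q.IsPrime := hq.1.1
  have hyq : y ∈ q := hq.1.2 (Ideal.subset_span (by simp [s]))
  have hFq' : ∀ i, i ≠ k → F i ∈ q := fun i hi =>
    hq.1.2 (Ideal.subset_span (by simpa [s] using Or.inr ⟨i, hi, rfl⟩))
  have hFk : F k ∈ q := by
    -- The factor `u k - a k` lies outside `m`, hence outside `q`, because `a k ∈ m`.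
    have h1 : (u k - a k) * F k ∈ q := by
      have h2 : (u k - a k) * F k = z - ∑ i ∈ Finset.univ.erase k, (u i - a i) * F i := by
        rw [eq_sub_iff_add_eq,
          Finset.add_sum_erase _ (fun i => (u i - a i) * F i) (Finset.mem_univ k)]
        simp only [sub_mul, Finset.sum_sub_distrib]
        rw [← hyz]
        simp
      rw [h2]
      refine q.sub_mem ((Ideal.span_singleton_le_iff_mem q).2 hyq hzy) ?_
      exact q.sum_mem fun i hi => q.mul_mem_left _ (hFq' i (Finset.ne_of_mem_erase hi))
    refine (hqp.mem_or_mem h1).resolve_left fun h3 => hk ?_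
    exact (Submodule.sub_mem_iff_left m (ha k)).1 (hqm h3)
  refine ⟨q, hqp, fun i => ?_, hyq,
    (Ideal.height_le_card_of_mem_minimalPrimes_span_finset hq).trans (by exact_mod_cast hs)⟩
  by_cases hi : i = k
  · exact hi ▸ hFk
  · exact hFq' i hi

/-- A nonzero `v` makes the gradient of `∑ v i F i` vanish at `x`, so one equation becomes redundant
near `x` and some prime over the chart ideal has height at most `c`. Homogeneity forces height at
least `c + 1`. -/
theorem IsSmoothCompleteIntersection.eq_zero_of_chart {K : Type*} [Field K] {N c : ℕ}
    {d : Fin c → ℕ} {F : Fin c → MvPolynomial (Fin (N + 1)) K}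
    (h : IsSmoothCompleteIntersection d F) {x : Fin (N + 1) → K} {j : Fin (N + 1)} (hj : x j = 1)
    (hx : ∀ i, eval x (F i) = 0) {v : Fin c → K}
    (hv : ∀ l, ∑ i, v i * eval x (pderiv l (F i)) = 0) : v = 0 := by
  classical
  by_contra hne
  obtain ⟨k, hk⟩ := Function.ne_iff.1 hne
  have hmp : (RingHom.ker (eval x)).IsPrime := RingHom.ker_isPrime _
  have hFm : ∀ i, F i ∈ RingHom.ker (eval x) := fun i => RingHom.mem_ker.2 (hx i)
  have hXm : X j - 1 ∈ RingHom.ker (eval x) := RingHom.mem_ker.2 (by simp [hj])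
  have : Algebra.Smooth K (ChartRing F j) := h.smooth j
  have hG : ∑ i, C (v i) * F i ∈
      RingHom.ker (eval x) * (Ideal.span (Set.range F) ⊔ Ideal.span {X j - 1}) := by
    refine mem_mul_of_formallySmooth _ _ (sup_le (Ideal.span_le.2 ?_) (Ideal.span_le.2 ?_)) _ ?_
      fun l => ?_
    · rintro _ ⟨i, rfl⟩
      exact hFm i
    · exact Set.singleton_subset_iff.2 hXm
    · exact Ideal.sum_mem _ fun i _ => Ideal.mul_mem_left _ _
        (Ideal.mem_sup_left (Ideal.subset_span ⟨i, rfl⟩))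
    · rw [RingHom.mem_ker, ← hv l]
      simp [Derivation.leibniz]
  obtain ⟨q, hqp, hFq, hXq, hqc⟩ := exists_isPrime_height_le F (X j - 1) _ hFm hXm
    (fun i => C (v i)) k (fun h0 => hk (by simpa using RingHom.mem_ker.1 h0)) hG
  have h1 := (height_add_one_le_of_isHomogeneous h.isHomogeneous q hFq j hXq).trans hqc
  rw [h.height_eq] at h1
  have h4 : c + 1 ≤ c := by exact_mod_cast h1
  omega

/-- Nonvanishing of the Jacobian at the points of the projective zero locus. -/
def IsNondegenerate {K ι σ : Type*} [Field K] [Fintype ι] (F : ι → MvPolynomial σ K) : Prop :=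
  ∀ x : σ → K, x ≠ 0 → (∀ i, eval x (F i) = 0) →
    ∀ v : ι → K, (∀ l, ∑ i, v i * eval x (pderiv l (F i)) = 0) → v = 0

theorem eval_smul_of_isHomogeneous {K σ : Type*} [Field K] {p : MvPolynomial σ K} {n : ℕ}
    (hp : p.IsHomogeneous n) (t : K) (x : σ → K) : eval (t • x) p = t ^ n * eval x p := by
  rw [eval_eq, eval_eq, Finset.mul_sum]
  refine Finset.sum_congr rfl fun m hm => ?_
  have h1 := hp (mem_support_iff.1 hm)
  simp only [Pi.smul_apply, smul_eq_mul, mul_pow, Finset.prod_mul_distrib]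
  rw [Finset.prod_pow_eq_pow_sum, ← h1, Finsupp.weight_apply, Finsupp.sum]
  simp only [Pi.one_apply, smul_eq_mul, mul_one]
  ring

/-- The chart may depend on the point; `exists_isNondegenerate` uses this freedom to avoid one chart
altogether. -/
theorem isNondegenerate_of_chart {K ι σ : Type*} [Field K] [Fintype ι] {d : ι → ℕ}
    {F : ι → MvPolynomial σ K} (hF : ∀ i, (F i).IsHomogeneous (d i))
    (h : ∀ x : σ → K, x ≠ 0 → (∀ i, eval x (F i) = 0) → ∃ j, x j ≠ 0 ∧
      ∀ y : σ → K, y j = 1 → (∀ i, eval y (F i) = 0) →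
        ∀ v : ι → K, (∀ l, ∑ i, v i * eval y (pderiv l (F i)) = 0) → v = 0) :
    IsNondegenerate F := by
  intro x hx hxF v hv
  obtain ⟨j, hj, hjv⟩ := h x hx hxF
  have h1 := hjv ((x j)⁻¹ • x) (by simp [hj])
    (fun i => by rw [eval_smul_of_isHomogeneous (hF i), hxF, mul_zero])
    -- Rescaling `x` by `(x j)⁻¹` divides the gradient of `F i` by `x j ^ (d i - 1)`; the
    -- coefficients compensate for this.
    (fun i => v i * x j ^ (d i - 1)) fun l => by
      rw [← hv l]
      refine Finset.sum_congr rfl fun i _ => ?_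
      rw [eval_smul_of_isHomogeneous (hF i).pderiv, inv_pow]
      field_simp
  funext i
  have h2 := congrFun h1 i
  exact (mul_eq_zero.1 h2).resolve_right (pow_ne_zero _ hj)

theorem IsSmoothCompleteIntersection.isNondegenerate {K : Type*} [Field K] {N c : ℕ}
    {d : Fin c → ℕ} {F : Fin c → MvPolynomial (Fin (N + 1)) K}
    (h : IsSmoothCompleteIntersection d F) : IsNondegenerate F :=
  isNondegenerate_of_chart h.isHomogeneous fun x hx _ => by
    obtain ⟨j, hj⟩ := Function.ne_iff.1 hx
    exact ⟨j, hj, fun y hy hyF v hv => h.eq_zero_of_chart hy hyF hv⟩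

/-! ### The counting inequality and its integration -/

/-- The layer-cake formula in discrete form: this replaces integrating the counts over `s > 0`. -/
theorem sum_le_sum_of_card_filter_le {ι κ : Type*} [DecidableEq ι] [DecidableEq κ] (u : ι → ℝ)
    (v : κ → ℝ) (S : Finset ι) (T : Finset κ) (hv : ∀ j ∈ T, 0 ≤ v j)
    (h : ∀ s > 0, (S.filter fun i => s ≤ u i).card ≤ (T.filter fun j => s ≤ v j).card) :
    ∑ i ∈ S, u i ≤ ∑ j ∈ T, v j := by
  induction S using Finset.induction_on_max_value u generalizing T with
  | empty => simpa using Finset.sum_nonneg hv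
  | insert a S ha hmax ih =>
    rcases le_or_gt (u a) 0 with h0 | h0
    · refine le_trans (Finset.sum_nonpos fun i hi => ?_) (Finset.sum_nonneg hv)
      rcases Finset.mem_insert.1 hi with rfl | hi
      · exact h0
      · exact (hmax i hi).trans h0
    · have h1 : 0 < (T.filter fun j => u a ≤ v j).card :=
        lt_of_lt_of_le (Finset.card_pos.2 ⟨a, by simp⟩) (h _ h0)
      obtain ⟨b, hb⟩ := Finset.card_pos.1 h1
      obtain ⟨hbT, hb⟩ := Finset.mem_filter.1 hb
      rw [Finset.sum_insert ha, ← Finset.add_sum_erase T v hbT]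
      refine add_le_add hb (ih _ (fun j hj => hv j (Finset.mem_of_mem_erase hj)) fun s hs => ?_)
      rcases le_or_gt s (u a) with hsa | hsa
      · have h2 := h s hs
        rw [Finset.filter_insert, if_pos hsa, Finset.card_insert_of_notMem (by simp [ha])] at h2
        rw [Finset.filter_erase, Finset.card_erase_of_mem (by simp [hbT, hsa.trans hb])]
        omega
      · rw [Finset.filter_false_of_mem fun i hi => not_le.2 ((hmax i hi).trans_lt hsa)]
        simp

theorem coe_alphaDeg {K : Type*} [Field K] {N : ℕ} (α : Fin (N + 1) → ℤ)
    {F : MvPolynomial (Fin (N + 1)) K} (hF : F ≠ 0) :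
    (alphaDeg α F : WithBot ℤ) = weightedTotalDegree' α F := by
  obtain ⟨w, hw⟩ := WithBot.ne_bot_iff_exists.1 (mt (weightedTotalDegree'_eq_bot_iff α F).1 hF)
  rw [alphaDeg, ← hw, WithBot.unbotD_coe]

theorem weight_le_alphaDeg {K : Type*} [Field K] {N : ℕ} (α : Fin (N + 1) → ℤ)
    {F : MvPolynomial (Fin (N + 1)) K} {m : Fin (N + 1) →₀ ℕ} (hm : m ∈ F.support) :
    Finsupp.weight α m ≤ alphaDeg α F := by
  have hF : F ≠ 0 := by
    rintro rfl
    simp at hm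
  rw [← WithBot.coe_le_coe, coe_alphaDeg α hF]
  exact Finset.le_sup (f := fun s => (Finsupp.weight α s : WithBot ℤ)) hm

theorem alphaDeg_le {K : Type*} [Field K] {N : ℕ} (α : Fin (N + 1) → ℤ)
    {F : MvPolynomial (Fin (N + 1)) K} (hF : F ≠ 0) {w : ℤ}
    (h : ∀ m ∈ F.support, Finsupp.weight α m ≤ w) : alphaDeg α F ≤ w := by
  rw [← WithBot.coe_le_coe, coe_alphaDeg α hF]
  exact Finset.sup_le fun m hm => WithBot.coe_le_coe.2 (h m hm)

/-- A monomial of degree `n` and weight less than `n * t` must involve a variable of weight less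
than `t`. -/
theorem eval_eq_zero_of_weight_lt {K : Type*} [Field K] {N : ℕ} (α : Fin (N + 1) → ℤ)
    {p : MvPolynomial (Fin (N + 1)) K} {n : ℕ} (hp : p.IsHomogeneous n) {t : ℝ}
    (ht : ∀ m ∈ p.support, (Finsupp.weight α m : ℝ) < n * t) {x : Fin (N + 1) → K}
    (hx : ∀ i, (α i : ℝ) < t → x i = 0) : eval x p = 0 := by
  rw [eval_eq]
  refine Finset.sum_eq_zero fun m hm => ?_
  have h1 : ∃ i ∈ m.support, (α i : ℝ) < t := by
    by_contra! hcon
    refine absurd (ht m hm) (not_lt.2 ?_)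
    have h2 := hp (mem_support_iff.1 hm)
    rw [← h2, Finsupp.weight_apply, Finsupp.weight_apply, Finsupp.sum, Finsupp.sum]
    push_cast
    rw [Finset.sum_mul]
    refine Finset.sum_le_sum fun i hi => ?_
    simp only [Pi.one_apply, smul_eq_mul, mul_one, nsmul_eq_mul, Int.cast_mul, Int.cast_natCast]
    exact mul_le_mul_of_nonneg_left (hcon i hi) (by positivity)
  obtain ⟨i, hi, hit⟩ := h1
  rw [Finset.prod_eq_zero hi (by rw [hx i hit, zero_pow (Finsupp.mem_support_iff.1 hi)]), mul_zero]

theorem eval_eq_zero_of_alphaDeg_lt {K : Type*} [Field K] {N : ℕ} (α : Fin (N + 1) → ℤ)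
    {p : MvPolynomial (Fin (N + 1)) K} {n : ℕ} (hp : p.IsHomogeneous n) {t : ℝ}
    (ht : (alphaDeg α p : ℝ) < n * t) {x : Fin (N + 1) → K}
    (hx : ∀ i, (α i : ℝ) < t → x i = 0) : eval x p = 0 :=
  eval_eq_zero_of_weight_lt α hp
    (fun _ hm => (Int.cast_le.2 (weight_le_alphaDeg α hm)).trans_lt ht) hx

theorem eval_pderiv_eq_zero_of_alphaDeg_lt {K : Type*} [Field K] {N : ℕ} (α : Fin (N + 1) → ℤ)
    {p : MvPolynomial (Fin (N + 1)) K} {n : ℕ} (hp : p.IsHomogeneous n) {t : ℝ} (l : Fin (N + 1))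
    (ht : (alphaDeg α p : ℝ) - (n - 1 : ℕ) * t < α l) {x : Fin (N + 1) → K}
    (hx : ∀ i, (α i : ℝ) < t → x i = 0) : eval x (pderiv l p) = 0 := by
  refine eval_eq_zero_of_weight_lt α hp.pderiv (fun m hm => ?_) hx
  have h1 : m + Finsupp.single l 1 ∈ p.support := by
    rw [mem_support_iff, coeff_pderiv] at hm
    exact mem_support_iff.2 (left_ne_zero_of_mul hm)
  have h2 : ((Finsupp.weight α (m + Finsupp.single l 1) : ℤ) : ℝ) ≤ alphaDeg α p :=
    Int.cast_le.2 (weight_le_alphaDeg α h1)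
  rw [map_add, Finsupp.weight_single, one_smul] at h2
  push_cast at h2
  linarith

theorem IsNondegenerate.exists_pderiv_ne_zero {K ι σ : Type*} [Field K] [Fintype ι]
    {F : ι → MvPolynomial σ K} (h : IsNondegenerate F) {x : σ → K} (hx : x ≠ 0)
    (hF : ∀ i, eval x (F i) = 0) (k : ι) : ∃ l, eval x (pderiv l (F k)) ≠ 0 := by
  classical
  by_contra! hcon
  have h1 := congrFun (h x hx hF (Pi.single k 1) fun l => by
    rw [Finset.sum_eq_single k]
    · simp [hcon]
    · intro i _ hi
      simp [hi]
    · simp) k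
  simp at h1

/-- Otherwise the coordinates outside `A`, the equations in `D` and the derivatives of `F k` in the
directions of `B` are at most `N` polynomials. Since all `d j ≥ 2`, none has a constant term, so
they have a nonzero common zero. There the remaining equations and derivatives vanish for reasons of
weight. -/
theorem card_filter_le_of_alphaDeg_lt {K : Type*} [Field K] [IsAlgClosed K] {N c : ℕ}
    {d : Fin c → ℕ} (hd : ∀ i, 2 ≤ d i) {F : Fin c → MvPolynomial (Fin (N + 1)) K}
    (hF : ∀ i, (F i).IsHomogeneous (d i)) (hJ : IsNondegenerate F) (α : Fin (N + 1) → ℤ)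
    (k : Fin c) (t : ℝ) :
    (Finset.univ.filter fun i => t ≤ α i).card ≤
      (Finset.univ.filter fun j => d j * t ≤ alphaDeg α (F j)).card +
      (Finset.univ.filter fun i => (α i : ℝ) ≤ alphaDeg α (F k) - (d k - 1 : ℕ) * t).card := by
  classical
  by_contra! hlt
  let A := Finset.univ.filter fun i => t ≤ (α i : ℝ)
  let D := Finset.univ.filter fun j => (d j : ℝ) * t ≤ alphaDeg α (F j)
  let B := Finset.univ.filter fun i => (α i : ℝ) ≤ alphaDeg α (F k) - (d k - 1 : ℕ) * t
  let s : Finset (MvPolynomial (Fin (N + 1)) K) :=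
    Aᶜ.image X ∪ (D.image F ∪ B.image fun l => pderiv l (F k))
  have hs : s.card < Fintype.card (Fin (N + 1)) := by
    have h1 : s.card ≤ Aᶜ.card + (D.card + B.card) :=
      (Finset.card_union_le _ _).trans (add_le_add Finset.card_image_le
        ((Finset.card_union_le _ _).trans (add_le_add Finset.card_image_le Finset.card_image_le)))
    have h2 : A.card + Aᶜ.card = Fintype.card (Fin (N + 1)) := Finset.card_add_card_compl A
    have h3 : D.card + B.card < A.card := hlt
    omega
  have h0 : ∀ {p : MvPolynomial (Fin (N + 1)) K} {n : ℕ}, p.IsHomogeneous n → n ≠ 0 →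
      eval 0 p = 0 := fun hp hn => by
    have := eval_smul_of_isHomogeneous hp 0 0
    rwa [zero_smul, zero_pow hn, zero_mul] at this
  obtain ⟨x, hx, hxs⟩ := exists_ne_zero_forall_eval_eq_zero s (fun p hp => by
    simp only [s, Finset.mem_union, Finset.mem_image] at hp
    rcases hp with ⟨i, -, rfl⟩ | ⟨j, -, rfl⟩ | ⟨l, -, rfl⟩
    · simp
    · exact h0 (hF j) (by have := hd j; omega)
    · exact h0 (hF k).pderiv (by have := hd k; omega)) hs
  have hxA : ∀ i, (α i : ℝ) < t → x i = 0 := fun i hi => by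
    have := hxs (X i) (Finset.mem_union_left _ (Finset.mem_image_of_mem _ (by simpa [A] using hi)))
    simpa using this
  have hxF : ∀ j, eval x (F j) = 0 := fun j => by
    rcases lt_or_ge (alphaDeg α (F j) : ℝ) (d j * t) with hj | hj
    · exact eval_eq_zero_of_alphaDeg_lt α (hF j) hj hxA
    · exact hxs _ (Finset.mem_union_right _ (Finset.mem_union_left _
        (Finset.mem_image_of_mem _ (by simpa [D] using hj))))
  obtain ⟨l, hl⟩ := hJ.exists_pderiv_ne_zero hx hxF k
  apply hl
  rcases lt_or_ge ((alphaDeg α (F k) : ℝ) - (d k - 1 : ℕ) * t) (α l) with hj | hj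
  · exact eval_pderiv_eq_zero_of_alphaDeg_lt α (hF k) l hj hxA
  · exact hxs _ (Finset.mem_union_right _ (Finset.mem_union_right _
      (Finset.mem_image_of_mem (fun l => pderiv l (F k)) (by simpa [B] using hj))))

theorem card_filter_sumElim {ι κ : Type*} [Fintype ι] [Fintype κ] (f : ι → ℝ) (g : κ → ℝ)
    (s : ℝ) :
    (Finset.univ.filter fun i => s ≤ Sum.elim f g i).card =
      (Finset.univ.filter fun i => s ≤ f i).card + (Finset.univ.filter fun i => s ≤ g i).card := by
  simp only [Finset.card_filter, Fintype.sum_sum_type, Sum.elim_inl, Sum.elim_inr]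
  rfl

/-- If the `k`-th slope `deg_α(F_k) / d_k` is minimal, the slopes bound the weights. -/
theorem sum_max_sub_le {K : Type*} [Field K] [IsAlgClosed K] {N c : ℕ}
    {d : Fin c → ℕ} (hd : ∀ i, 2 ≤ d i) {F : Fin c → MvPolynomial (Fin (N + 1)) K}
    (hF : ∀ i, (F i).IsHomogeneous (d i)) (hJ : IsNondegenerate F) (α : Fin (N + 1) → ℤ)
    (k : Fin c) (y : Fin c → ℝ) (hy : ∀ j, y j = (alphaDeg α (F j) : ℝ) / d j)
    (hk : ∀ j, y k ≤ y j) :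
    ∑ i, max (α i - y k) 0 ≤
      ∑ j, (y j - y k) + (∑ i, max (y k - α i) 0) / (d k - 1 : ℕ) := by
  classical
  have hd1 : (0 : ℝ) < (d k - 1 : ℕ) := by
    have := hd k
    exact_mod_cast (by omega : 0 < d k - 1)
  have hd2 : ((d k - 1 : ℕ) : ℝ) = d k - 1 := by
    rw [Nat.cast_sub (by have := hd k; omega)]
    simp
  have hd0 : ∀ j, (0 : ℝ) < d j := fun j => by
    have := hd j
    exact_mod_cast (by omega : 0 < d j)
  have hdeg : ∀ j, (alphaDeg α (F j) : ℝ) = d j * y j := fun j => by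
    rw [hy, mul_div_cancel₀ _ (hd0 j).ne']
  have hsum : ∑ j, (y j - y k) + (∑ i, max (y k - α i) 0) / (d k - 1 : ℕ) =
      ∑ i, Sum.elim (fun j => y j - y k) (fun i => max (y k - α i) 0 / (d k - 1 : ℕ)) i := by
    rw [Fintype.sum_sum_type, Finset.sum_div]
    rfl
  rw [hsum]
  refine sum_le_sum_of_card_filter_le _ _ _ _ (fun j _ => ?_) fun s hs => ?_
  · rcases j with j | i
    · exact sub_nonneg.2 (hk j)
    · exact div_nonneg (le_max_right _ _) hd1.le
  · rw [card_filter_sumElim]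
    -- At `t = s + y k` the bound on `α i` in the last count is `y k - (d k - 1) s`.
    refine (le_of_eq ?_).trans ((card_filter_le_of_alphaDeg_lt hd hF hJ α k (s + y k)).trans
      (le_of_eq ?_))
    · congr 1
      refine Finset.filter_congr fun i _ => ?_
      rw [le_max_iff, or_iff_left (not_le.2 hs), le_sub_iff_add_le]
    · congr 2
      · refine Finset.filter_congr fun j _ => ?_
        rw [hdeg, mul_le_mul_iff_right₀ (hd0 j), le_sub_iff_add_le]
      · refine Finset.filter_congr fun i _ => ?_
        rw [le_div_iff₀ hd1, le_max_iff, or_iff_left (not_le.2 (mul_pos hs hd1)), hdeg, hd2]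
        constructor <;> intro h <;> linarith

/-- As `d k - 1 ≥ 1`, the denominator in `sum_max_sub_le` can be dropped. The positive and negative
parts of `α i - y k` then combine to `∑ (α i - y k) = -(N + 1) y k`. -/
theorem sum_slope_nonneg {K : Type*} [Field K] [IsAlgClosed K] {N c : ℕ}
    {d : Fin c → ℕ} (hd : ∀ i, 2 ≤ d i) {F : Fin c → MvPolynomial (Fin (N + 1)) K}
    (hF : ∀ i, (F i).IsHomogeneous (d i)) (hJ : IsNondegenerate F) {α : Fin (N + 1) → ℤ}
    (hα : ∑ i, α i = 0)
    (k : Fin c) (y : Fin c → ℝ) (hy : ∀ j, y j = (alphaDeg α (F j) : ℝ) / d j)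
    (hk : ∀ j, y k ≤ y j) : 0 ≤ ∑ j, (y j - y k) + (N + 1) * y k := by
  have h1 := sum_max_sub_le hd hF hJ α k y hy hk
  have hd1 : (1 : ℝ) ≤ (d k - 1 : ℕ) := by
    have := hd k
    exact_mod_cast (by omega : 1 ≤ d k - 1)
  have h2 : (∑ i, max (y k - α i) 0) / (d k - 1 : ℕ) ≤ ∑ i, max (y k - α i) 0 :=
    div_le_self (Finset.sum_nonneg fun _ _ => le_max_right _ _) hd1
  have h3 : ∑ i, max (α i - y k) 0 - ∑ i, max (y k - α i) 0 = ∑ i, ((α i : ℝ) - y k) := by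
    rw [← Finset.sum_sub_distrib]
    refine Finset.sum_congr rfl fun i _ => ?_
    rcases le_total (α i - y k) 0 with h | h
    · rw [max_eq_right h, max_eq_left (by linarith)]; ring
    · rw [max_eq_left h, max_eq_right (by linarith)]; ring
  have h4 : ∑ i, (α i : ℝ) = 0 := by exact_mod_cast hα
  rw [Finset.sum_sub_distrib, h4] at h3
  simp only [Finset.sum_const, Finset.card_univ, Fintype.card_fin, nsmul_eq_mul] at h3
  push_cast at h3
  linarith

/-! ### Some equation has nonzero `α`-degree -/

/-- A pencil of square matrices has a singular member. -/
theorem exists_pencil_eq_zero {K V W : Type*} [Field K] [IsAlgClosed K] [AddCommGroup V]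
    [Module K V] [AddCommGroup W] [Module K W] [FiniteDimensional K V] [FiniteDimensional K W]
    [Nontrivial V] (h : Module.finrank K V = Module.finrank K W) (f g : V →ₗ[K] W) :
    ∃ (a b : K) (x : V), (a ≠ 0 ∨ b ≠ 0) ∧ x ≠ 0 ∧ a • f x + b • g x = 0 := by
  by_cases hg : Function.Injective g
  · let e := LinearEquiv.ofInjectiveOfFinrankEq g hg h
    obtain ⟨μ, hμ⟩ := Module.End.exists_eigenvalue (e.symm.toLinearMap ∘ₗ f)
    obtain ⟨x, hx⟩ := hμ.exists_hasEigenvector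
    refine ⟨1, -μ, x, Or.inl one_ne_zero, hx.2, ?_⟩
    have h1 := congrArg e hx.apply_eq_smul
    simp only [LinearMap.comp_apply, LinearEquiv.coe_coe, LinearEquiv.apply_symm_apply,
      map_smul] at h1
    rw [one_smul, h1, neg_smul]
    exact add_neg_cancel _
  · rw [injective_iff_map_eq_zero] at hg
    push Not at hg
    obtain ⟨x, hx, hx0⟩ := hg
    exact ⟨0, 1, x, Or.inr one_ne_zero, hx0, by simp [hx]⟩

theorem exists_linearMap_eq_eval {K σ : Type*} [Field K] {p : MvPolynomial σ K}
    (hp : p.IsHomogeneous 1) : ∃ L : (σ → K) →ₗ[K] K, ∀ x, L x = eval x p := by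
  have h1 : p ∈ homogeneousSubmodule σ K 1 := hp
  rw [homogeneousSubmodule_one_eq_span_X] at h1
  clear hp
  induction h1 using Submodule.span_induction with
  | mem p hp =>
    obtain ⟨i, rfl⟩ := hp
    exact ⟨LinearMap.proj i, fun x => by simp⟩
  | zero => exact ⟨0, by simp⟩
  | add p q hp hq ihp ihq =>
    obtain ⟨L, hL⟩ := ihp
    obtain ⟨M, hM⟩ := ihq
    exact ⟨L + M, fun x => by simp [hL, hM]⟩
  | smul a p hp ihp =>
    obtain ⟨L, hL⟩ := ihp
    exact ⟨a • L, fun x => by simp [hL, smul_eval]⟩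

/-- If all degrees were zero, every `F j` would vanish on the space of vectors supported on `H`, and
there only the derivatives in the directions of `B` could be nonzero. Being linear, those of `F k`
and `F k'` form two square matrices. A singular member of their pencil gives a point with dependent
gradients. -/
theorem exists_alphaDeg_ne_zero_of_card_eq {K : Type*} [Field K] [IsAlgClosed K] {N c : ℕ}
    {F : Fin c → MvPolynomial (Fin (N + 1)) K}
    (hF : ∀ i, (F i).IsHomogeneous 2) (hJ : IsNondegenerate F) (α : Fin (N + 1) → ℤ)
    {k k' : Fin c} (hk : k ≠ k') {s : ℝ} (hs : 0 < s)
    (hcard : (Finset.univ.filter fun i => s ≤ α i).card =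
      (Finset.univ.filter fun i => (α i : ℝ) ≤ -s).card)
    (hpos : 0 < (Finset.univ.filter fun i => s ≤ α i).card) : ∃ j, alphaDeg α (F j) ≠ 0 := by
  classical
  by_contra! h0
  let H := {i // s ≤ (α i : ℝ)}
  let B := {i // (α i : ℝ) ≤ -s}
  have hHB : Fintype.card H = Fintype.card B := by
    rw [Fintype.card_subtype, Fintype.card_subtype]
    exact hcard
  have : Nonempty H := Fintype.card_pos_iff.1 (by rw [Fintype.card_subtype]; exact hpos)
  choose L hL using fun j l => exists_linearMap_eq_eval (hF j).pderiv (p := pderiv l (F j))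
  let E : (H → K) →ₗ[K] (Fin (N + 1) → K) := Function.ExtendByZero.linearMap K Subtype.val
  let M : Fin c → (H → K) →ₗ[K] (B → K) := fun j => (LinearMap.pi fun l : B => L j l) ∘ₗ E
  obtain ⟨a, b, x, hab, hx, hM⟩ := exists_pencil_eq_zero (by simpa using hHB) (M k) (M k')
  have hE : E x ≠ 0 := fun h => hx <| funext fun i => by
    have h1 := congrFun h i.1
    rwa [Function.ExtendByZero.linearMap_apply, Subtype.val_injective.extend_apply] at h1
  have hE0 : ∀ i, (α i : ℝ) < s → E x i = 0 := fun i hi => by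
    rw [Function.ExtendByZero.linearMap_apply, Function.extend_apply']
    · rfl
    · rintro ⟨a, rfl⟩
      exact absurd a.2 (not_le.2 hi)
  have h1 := hJ (E x) hE
    (fun j => eval_eq_zero_of_alphaDeg_lt α (hF j) (by rw [h0]; push_cast; linarith) hE0)
    (Pi.single k a + Pi.single k' b) fun l => by
      simp only [Pi.add_apply, add_mul, Finset.sum_add_distrib, Pi.single_apply, ite_mul, zero_mul,
        Finset.sum_ite_eq', Finset.mem_univ, if_true]
      rcases le_or_gt (α l : ℝ) (-s) with hl | hl
      · have h2 := congrFun hM ⟨l, hl⟩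
        simpa [M, hL] using h2
      · rw [eval_pderiv_eq_zero_of_alphaDeg_lt α (hF k) l (by rw [h0]; push_cast; linarith) hE0,
          eval_pderiv_eq_zero_of_alphaDeg_lt α (hF k') l (by rw [h0]; push_cast; linarith) hE0]
        simp
  rcases hab with ha | hb
  · exact ha (by simpa [hk] using congrFun h1 k)
  · exact hb (by simpa [hk.symm] using congrFun h1 k')

theorem IsWeight.sum_max {N : ℕ} {α : Fin (N + 1) → ℤ} (hα : IsWeight α) :
    0 < ∑ i, max (α i : ℝ) 0 ∧ ∑ i, max (α i : ℝ) 0 = ∑ i, max (-α i : ℝ) 0 := by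
  have h3 : ∑ i, max (α i : ℝ) 0 - ∑ i, max (-α i : ℝ) 0 = ∑ i, (α i : ℝ) := by
    rw [← Finset.sum_sub_distrib]
    refine Finset.sum_congr rfl fun i _ => ?_
    rcases le_total (α i : ℝ) 0 with h | h
    · rw [max_eq_right h, max_eq_left (by linarith)]; ring
    · rw [max_eq_left h, max_eq_right (by linarith)]; ring
  have h4 : ∑ i, (α i : ℝ) = 0 := by exact_mod_cast hα.sum_eq_zero
  rw [h4, sub_eq_zero] at h3
  refine ⟨?_, h3⟩
  obtain ⟨i, hi⟩ := hα.ne_zero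
  rcases lt_or_gt_of_ne hi with hi | hi
  · rw [h3]
    refine Finset.sum_pos' (fun _ _ => le_max_right _ _) ⟨i, Finset.mem_univ _, ?_⟩
    exact lt_max_of_lt_left (by simpa using hi)
  · refine Finset.sum_pos' (fun _ _ => le_max_right _ _) ⟨i, Finset.mem_univ _, ?_⟩
    exact lt_max_of_lt_left (by simpa using hi)

/-- With all degrees zero, the positive and negative parts of `α` have the same positive sum, so
`sum_max_sub_le` forces `d k = 2`. For two or more quadrics the pencil argument makes the counts
strict, which the integration turns into a strict inequality between these equal sums. -/
theorem exists_alphaDeg_ne_zero {K : Type*} [Field K] [IsAlgClosed K] {N c : ℕ} (hc : 1 ≤ c)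
    {d : Fin c → ℕ} (hd : ∀ i, 2 ≤ d i) (hcd : ¬ (c = 1 ∧ d ⟨0, hc⟩ = 2))
    {F : Fin c → MvPolynomial (Fin (N + 1)) K}
    (hF : ∀ i, (F i).IsHomogeneous (d i)) (hJ : IsNondegenerate F) {α : Fin (N + 1) → ℤ}
    (hα : IsWeight α) : ∃ j, alphaDeg α (F j) ≠ 0 := by
  classical
  by_contra! h0
  obtain ⟨hpos, hsum⟩ := hα.sum_max
  have hd2 : ∀ k, d k = 2 := fun k => by
    have h1 := sum_max_sub_le hd hF hJ α k 0 (by simp [h0]) (by simp)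
    simp only [Pi.zero_apply, sub_zero, zero_sub, Finset.sum_const_zero, zero_add, ← hsum] at h1
    have h2 := hd k
    by_contra h3
    have h4 : (2 : ℝ) ≤ (d k - 1 : ℕ) := by exact_mod_cast (by omega : 2 ≤ d k - 1)
    rw [le_div_iff₀ (by linarith)] at h1
    nlinarith
  obtain rfl : d = fun _ => 2 := funext hd2
  have hc2 : 2 ≤ c := by
    by_contra h
    exact hcd ⟨by omega, rfl⟩
  have hle : ∀ s : ℝ, (Finset.univ.filter fun i => s ≤ α i).card ≤
      (Finset.univ.filter fun j : Fin c => 2 * s ≤ 0).card +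
      (Finset.univ.filter fun i => (α i : ℝ) ≤ -s).card := fun s => by
    simpa [h0] using card_filter_le_of_alphaDeg_lt hd hF hJ α ⟨0, hc⟩ s
  have hlt : ∀ s : ℝ, 0 < s → 0 < (Finset.univ.filter fun i => s ≤ α i).card →
      (Finset.univ.filter fun i => s ≤ α i).card <
        (Finset.univ.filter fun i => (α i : ℝ) ≤ -s).card := fun s hs hs' => by
    have h1 := hle s
    rw [Finset.filter_false_of_mem (s := (Finset.univ : Finset (Fin c))) fun _ _ =>
      not_le.2 (by linarith), Finset.card_empty, zero_add] at h1
    refine lt_of_le_of_ne h1 fun heq => ?_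
    obtain ⟨j, hj⟩ := exists_alphaDeg_ne_zero_of_card_eq hF hJ α
      (k := ⟨0, by omega⟩) (k' := ⟨1, by omega⟩) (by simp) hs heq hs'
    exact hj (h0 j)
  obtain ⟨b, -, hb⟩ := Finset.exists_lt_of_sum_lt (s := Finset.univ) (f := fun _ => (0 : ℝ))
    (g := fun i => max (-α i : ℝ) 0) (by simpa [← hsum] using hpos)
  have h1 := sum_le_sum_of_card_filter_le (fun i => max (α i : ℝ) 0)
    -- The strict counts leave room to discard one index `b` with `α b < 0`.
    (fun i => max (-α i : ℝ) 0) Finset.univ (Finset.univ.erase b)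
    (fun _ _ => le_max_right _ _) fun s hs => by
      simp only [le_max_iff, or_iff_left (not_le.2 hs)]
      rw [Finset.filter_erase]
      refine le_trans ?_ (Finset.pred_card_le_card_erase)
      have h2 := hlt s hs
      have h3 : (Finset.univ.filter fun i => s ≤ (-α i : ℝ)) =
        Finset.univ.filter fun i => (α i : ℝ) ≤ -s := Finset.filter_congr fun i _ => le_neg
      rw [h3]
      omega
  rw [hsum, ← Finset.add_sum_erase _ _ (Finset.mem_univ b)] at h1
  linarith

/-! ### From the slope inequality to statements (i) and (ii) -/

theorem sum_mul_eq {N c : ℕ} (k y : Fin c → ℝ) (y₀ : ℝ) :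
    ∑ j, k j * y j = ∑ j, (k j - (∑ j, k j) / ((N : ℝ) + 1)) * (y j - y₀) +
      (∑ j, k j) / ((N : ℝ) + 1) * (∑ j, (y j - y₀) + (N + 1) * y₀) := by
  have hN : (N : ℝ) + 1 ≠ 0 := by positivity
  have h1 : (∑ j, k j) / ((N : ℝ) + 1) * ((N + 1) * y₀) = ∑ j, k j * y₀ := by
    rw [← Finset.sum_mul]
    field_simp
  rw [mul_add, h1, Finset.mul_sum, ← Finset.sum_add_distrib, ← Finset.sum_add_distrib]
  exact Finset.sum_congr rfl fun j _ => by ring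

theorem sum_mul_nonneg {N c : ℕ} (hcN : c ≤ N) (k y : Fin c → ℝ) (j₀ : Fin c)
    (hk : ∀ i, (∑ j, k j) / ((N : ℝ) + 1) ≤ k i) (hj₀ : ∀ j, y j₀ ≤ y j)
    (hy : 0 ≤ ∑ j, (y j - y j₀) + (N + 1) * y j₀) : 0 ≤ ∑ j, k j * y j := by
  have hN : (0 : ℝ) < (N : ℝ) + 1 := by positivity
  have hcN' : (c : ℝ) ≤ N := by exact_mod_cast hcN
  have h1 : (c : ℝ) * ((∑ j, k j) / ((N : ℝ) + 1)) ≤ ∑ j, k j := by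
    simpa using Finset.sum_le_sum fun j (_ : j ∈ Finset.univ) => hk j
  -- Writing `κ` for this quotient, `c κ ≤ ∑ k j = (N + 1) κ`, and `c < N + 1`.
  have h2 : 0 ≤ (∑ j, k j) / ((N : ℝ) + 1) := by
    by_contra! h3
    have h4 : (∑ j, k j) = (∑ j, k j) / ((N : ℝ) + 1) * (N + 1) := by field_simp
    nlinarith
  rw [sum_mul_eq (N := N) k y (y j₀)]
  exact add_nonneg (Finset.sum_nonneg fun j _ => mul_nonneg (sub_nonneg.2 (hk j))
    (sub_nonneg.2 (hj₀ j))) (mul_nonneg h2 hy)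

theorem sum_mul_pos {N c : ℕ} (hcN : c ≤ N) (k y : Fin c → ℝ) (j₀ : Fin c)
    (hk : ∀ i, (∑ j, k j) / ((N : ℝ) + 1) < k i) (hj₀ : ∀ j, y j₀ ≤ y j)
    (hy : 0 ≤ ∑ j, (y j - y j₀) + (N + 1) * y j₀) (hy0 : ∃ j, y j ≠ 0) :
    0 < ∑ j, k j * y j := by
  have hN : (0 : ℝ) < (N : ℝ) + 1 := by positivity
  have hcN' : (c : ℝ) ≤ N := by exact_mod_cast hcN
  have h1 : (c : ℝ) * ((∑ j, k j) / ((N : ℝ) + 1)) < ∑ j, k j := by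
    simpa using Finset.sum_lt_sum_of_nonempty ⟨j₀, Finset.mem_univ _⟩
      fun j (_ : j ∈ Finset.univ) => hk j
  have h2 : 0 < (∑ j, k j) / ((N : ℝ) + 1) := by
    by_contra! h3
    have h4 : (∑ j, k j) = (∑ j, k j) / ((N : ℝ) + 1) * (N + 1) := by field_simp
    nlinarith
  have h3 : ∀ j ∈ Finset.univ, 0 ≤ (k j - (∑ j, k j) / ((N : ℝ) + 1)) * (y j - y j₀) :=
    fun j _ => mul_nonneg (sub_nonneg.2 (hk j).le) (sub_nonneg.2 (hj₀ j))
  refine lt_of_le_of_ne (sum_mul_nonneg hcN k y j₀ (fun j => (hk j).le) hj₀ hy) fun heq => ?_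
  -- If the sum is zero, both nonnegative summands vanish: the slopes all agree, and their common
  -- value is zero.
  rw [sum_mul_eq (N := N) k y (y j₀), eq_comm,
    add_eq_zero_iff_of_nonneg (Finset.sum_nonneg h3) (mul_nonneg h2.le hy),
    Finset.sum_eq_zero_iff_of_nonneg h3] at heq
  have h4 : ∀ j, y j - y j₀ = 0 := fun j =>
    (mul_eq_zero.1 (heq.1 j (Finset.mem_univ j))).resolve_left (sub_pos.2 (hk j)).ne'
  have h5 := (mul_eq_zero.1 heq.2).resolve_left h2.ne'
  simp only [h4, Finset.sum_const_zero, zero_add] at h5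
  have h6 := (mul_eq_zero.1 h5).resolve_left hN.ne'
  obtain ⟨j, hj⟩ := hy0
  exact hj (by linarith [h4 j])

theorem weightedDegSum_nonneg {K : Type*} [Field K] [IsAlgClosed K] {N c : ℕ} (hc : 1 ≤ c)
    (hcN : c ≤ N) {d : Fin c → ℕ} (hd : ∀ i, 2 ≤ d i) {k : Fin c → ℝ}
    (hk : ∀ i, (∑ j, k j) / ((N : ℝ) + 1) ≤ k i) {α : Fin (N + 1) → ℤ}
    {F : Fin c → MvPolynomial (Fin (N + 1)) K} (hα : IsWeight α)
    (hF : IsSmoothCompleteIntersection d F) : 0 ≤ weightedDegSum d k α F := by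
  have : Nonempty (Fin c) := ⟨⟨0, hc⟩⟩
  obtain ⟨j₀, hj₀⟩ := Finite.exists_min fun j => (alphaDeg α (F j) : ℝ) / (d j : ℝ)
  exact sum_mul_nonneg hcN k _ j₀ hk hj₀ (sum_slope_nonneg hd hF.isHomogeneous
    hF.isNondegenerate hα.sum_eq_zero j₀ _ (fun _ => rfl) hj₀)

theorem weightedDegSum_pos {K : Type*} [Field K] [IsAlgClosed K] {N c : ℕ} (hc : 1 ≤ c)
    (hcN : c ≤ N) {d : Fin c → ℕ} (hd : ∀ i, 2 ≤ d i) (hcd : ¬ (c = 1 ∧ d ⟨0, hc⟩ = 2))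
    {k : Fin c → ℝ} (hk : ∀ i, (∑ j, k j) / ((N : ℝ) + 1) < k i) {α : Fin (N + 1) → ℤ}
    {F : Fin c → MvPolynomial (Fin (N + 1)) K} (hα : IsWeight α)
    (hF : IsSmoothCompleteIntersection d F) : 0 < weightedDegSum d k α F := by
  have : Nonempty (Fin c) := ⟨⟨0, hc⟩⟩
  obtain ⟨j₀, hj₀⟩ := Finite.exists_min fun j => (alphaDeg α (F j) : ℝ) / (d j : ℝ)
  refine sum_mul_pos hcN k _ j₀ hk hj₀ (sum_slope_nonneg hd hF.isHomogeneous
    hF.isNondegenerate hα.sum_eq_zero j₀ _ (fun _ => rfl) hj₀) ?_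
  obtain ⟨j, hj⟩ := exists_alphaDeg_ne_zero hc hd hcd hF.isHomogeneous hF.isNondegenerate hα
  refine ⟨j, div_ne_zero (by exact_mod_cast hj) ?_⟩
  have := hd j
  exact_mod_cast (by omega : d j ≠ 0)

/-! ### From independent gradients to smooth complete intersections -/

/-- A submodule of a finite free module over a polynomial ring over an algebraically closed field
is everything if it is so at all closed points. -/
theorem submodule_eq_top_of_forall_eval {K σ ι : Type*} [Field K] [IsAlgClosed K] [Finite σ]
    [Fintype ι] (U : Submodule (MvPolynomial σ K) (ι → MvPolynomial σ K))
    (hU : ∀ (x : σ → K) (v : ι → K), (∀ u ∈ U, ∑ i, eval x (u i) * v i = 0) → v = 0) :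
    U = ⊤ := by
  classical
  by_contra hne
  obtain ⟨M, hM, hUM⟩ := (eq_top_or_exists_le_coatom U).resolve_left hne
  have hs : IsSimpleModule (MvPolynomial σ K) ((ι → MvPolynomial σ K) ⧸ M) :=
    isSimpleModule_iff_isCoatom.2 hM
  -- The simple quotient is the residue field at a closed point `x`, so the projection is `u ↦ ∑ u i
  -- * p i` evaluated at `x`; the vector `p(x)` is nonzero and kills `U`.
  obtain ⟨I, hI, ⟨e⟩⟩ := isSimpleModule_iff_quot_maximal.1 hs
  obtain ⟨x, rfl⟩ := isMaximal_iff_eq_vanishingIdeal_singleton.1 hI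
  let φ : (ι → MvPolynomial σ K) →ₗ[MvPolynomial σ K] _ := e.toLinearMap ∘ₗ M.mkQ
  choose p hp using fun i => Ideal.Quotient.mk_surjective (φ (Pi.single i 1))
  have hφ : ∀ u, φ u = Ideal.Quotient.mk _ (∑ i, u i * p i) := fun u => by
    conv_lhs => rw [← Finset.univ_sum_single u]
    rw [map_sum, map_sum]
    refine Finset.sum_congr rfl fun i _ => ?_
    have h1 : (Pi.single i (u i) : ι → MvPolynomial σ K) = u i • Pi.single i 1 := by
      rw [← Pi.single_smul, smul_eq_mul, mul_one]
    rw [h1, map_smul, ← hp, map_mul]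
    rfl
  have hv := hU x (fun i => eval x (p i)) fun u hu => by
    have h1 : φ u = 0 := by
      rw [LinearMap.comp_apply, Submodule.mkQ_apply,
        (Submodule.Quotient.mk_eq_zero M).2 (hUM hu), map_zero]
    rw [hφ, Ideal.Quotient.eq_zero_iff_mem, mem_vanishingIdeal_singleton_iff] at h1
    simpa using h1
  apply hI.ne_top
  rw [Ideal.eq_top_iff_one]
  have hsurj : Function.Surjective φ := e.surjective.comp M.mkQ_surjective
  obtain ⟨u, hu⟩ := hsurj (Ideal.Quotient.mk _ 1)
  rw [hφ, eq_comm, Ideal.Quotient.eq, mem_vanishingIdeal_singleton_iff] at hu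
  have h2 : ∀ i, eval x (p i) = 0 := fun i => congrFun hv i
  rw [mem_vanishingIdeal_singleton_iff]
  simp [h2] at hu

/-- The Jacobian criterion. -/
theorem formallySmooth_of_jacobian {K σ ι : Type*} [Field K] [IsAlgClosed K] [Fintype σ]
    [Fintype ι] (G : ι → MvPolynomial σ K)
    (hG : ∀ x : σ → K, (∀ i, eval x (G i) = 0) →
      ∀ v : ι → K, (∀ l, ∑ i, v i * eval x (pderiv l (G i)) = 0) → v = 0) :
    Algebra.FormallySmooth K (MvPolynomial σ K ⧸ Ideal.span (Set.range G)) := by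
  classical
  set J := Ideal.span (Set.range G) with hJdef
  have hGJ : ∀ i, G i ∈ J := fun i => Ideal.subset_span ⟨i, rfl⟩
  -- The Jacobian matrix is surjective modulo `J`. Off the zero locus the summand `J ^ ι` suffices;
  -- on it the hypothesis applies.
  have htop : Submodule.span (MvPolynomial σ K) (Set.range fun l i => pderiv l (G i)) ⊔
      Submodule.pi Set.univ (fun _ : ι => (J : Submodule (MvPolynomial σ K) _)) = ⊤ := by
    refine submodule_eq_top_of_forall_eval _ fun x v hv => ?_
    by_cases hv0 : v = 0
    · exact hv0
    obtain ⟨k, hk⟩ := Function.ne_iff.1 hv0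
    refine hG x (fun i => ?_) v fun l => ?_
    · have h1 := hv (Pi.single k (G i)) (Submodule.mem_sup_right fun a _ => by
        by_cases ha : a = k
        · subst ha
          simpa using hGJ i
        · simp [ha])
      rw [Finset.sum_eq_single k] at h1
      · rw [Pi.single_eq_same] at h1
        exact (mul_eq_zero.1 h1).resolve_right hk
      · intro a _ ha
        simp [ha]
      · simp
    · rw [← hv _ (Submodule.mem_sup_left (Submodule.subset_span ⟨l, rfl⟩))]
      exact Finset.sum_congr rfl fun i _ => mul_comm _ _
  have hB : ∀ k : ι, ∃ b : σ → MvPolynomial σ K, ∀ i,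
      (Pi.single k 1 : ι → MvPolynomial σ K) i - ∑ l, b l * pderiv l (G i) ∈ J := fun k => by
    obtain ⟨y, hy, z, hz, hyz⟩ := Submodule.mem_sup.1
      (htop ▸ Submodule.mem_top : (Pi.single k 1 : ι → MvPolynomial σ K) ∈ _)
    obtain ⟨b, rfl⟩ := (Submodule.mem_span_range_iff_exists_fun _).1 hy
    refine ⟨b, fun i => ?_⟩
    rw [← hyz]
    simpa using hz i (Set.mem_univ i)
  choose b hb using hB
  -- A Newton step: `b` is a right inverse of the Jacobian matrix modulo `J`, so substituting `X l +
  -- h l` carries each `G i` into `J ^ 2` and yields the section.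
  let h : σ → MvPolynomial σ K := fun l => -∑ k, b k l * G k
  have hh : ∀ l, h l ∈ J := fun l =>
    J.neg_mem (J.sum_mem fun k _ => J.mul_mem_left _ (hGJ k))
  have hGsq : ∀ i, aeval (fun l => X l + h l) (G i) ∈ J ^ 2 := fun i => by
    have h1 := aeval_X_add_sub_mem_sq J h hh (G i)
    have h2 : G i + ∑ l, h l * pderiv l (G i) =
        ∑ k, ((Pi.single k 1 : ι → MvPolynomial σ K) i - ∑ l, b k l * pderiv l (G i)) * G k := by
      simp only [sub_mul, Finset.sum_sub_distrib, h, neg_mul, Finset.sum_neg_distrib]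
      rw [← sub_eq_add_neg]
      congr 1
      · simp [Pi.single_apply]
      · simp only [Finset.sum_mul]
        rw [Finset.sum_comm]
        exact Finset.sum_congr rfl fun k _ => Finset.sum_congr rfl fun l _ => by ring
    have h3 : G i + ∑ l, h l * pderiv l (G i) ∈ J ^ 2 := by
      rw [h2, pow_two]
      exact Ideal.sum_mem _ fun k _ => Ideal.mul_mem_mul (hb k i) (hGJ k)
    simpa using (J ^ 2).add_mem h1 h3
  let f := Ideal.Quotient.mkₐ K J
  have hker : RingHom.ker f.toRingHom = J := Ideal.Quotient.mkₐ_ker K J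
  let g : (MvPolynomial σ K ⧸ J) →ₐ[K] (MvPolynomial σ K ⧸ RingHom.ker f.toRingHom ^ 2) :=
    Ideal.Quotient.liftₐ J ((Ideal.Quotient.mkₐ K _).comp (aeval fun l => X l + h l)) (by
      intro a ha
      have h1 : J ≤ RingHom.ker ((Ideal.Quotient.mkₐ K (RingHom.ker f.toRingHom ^ 2)).comp
          (aeval fun l => X l + h l)) := by
        refine Ideal.span_le.2 ?_
        rintro _ ⟨i, rfl⟩
        refine RingHom.mem_ker.2 (Ideal.Quotient.eq_zero_iff_mem.2 ?_)
        rw [hker]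
        exact hGsq i
      exact h1 ha)
  refine Algebra.FormallySmooth.of_split f g ?_
  refine Ideal.Quotient.algHom_ext _ (MvPolynomial.algHom_ext fun l => ?_)
  change Ideal.Quotient.mk J (aeval (fun l => X l + h l) (X l)) = Ideal.Quotient.mk J (X l)
  rw [aeval_X, Ideal.Quotient.eq, add_sub_cancel_left]
  exact hh l

/-- The Jacobian criterion is applied to the `F i` together with `X j - 1`. Pairing a relation
between the gradients with `x` kills the contributions of the `F i` by Euler's formula, so the
coefficient of `X j - 1` is zero. -/
theorem smooth_chartRing {K : Type*} [Field K] [IsAlgClosed K] {N c : ℕ} {d : Fin c → ℕ}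
    {F : Fin c → MvPolynomial (Fin (N + 1)) K} (hF : ∀ i, (F i).IsHomogeneous (d i))
    (hJ : IsNondegenerate F) (j : Fin (N + 1)) : Algebra.Smooth K (ChartRing F j) := by
  let G : Option (Fin c) → MvPolynomial (Fin (N + 1)) K := fun i => i.elim (X j - 1) F
  have hspan : Ideal.span (Set.range G) = Ideal.span (Set.range F) ⊔ Ideal.span {X j - 1} := by
    rw [← Ideal.span_union, Option.range_eq, Set.insert_eq, Set.union_comm]
    rfl
  have h1 : Algebra.FormallySmooth K (MvPolynomial (Fin (N + 1)) K ⧸ Ideal.span (Set.range G)) := by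
    refine formallySmooth_of_jacobian G fun x hx v hv => ?_
    have hxj : x j = 1 := by simpa [G, sub_eq_zero] using hx none
    have hxF : ∀ i, eval x (F i) = 0 := fun i => hx (some i)
    have hx0 : x ≠ 0 := fun h => by simp [h] at hxj
    simp only [Fintype.sum_option] at hv
    have hEuler : ∀ i, ∑ l, x l * eval x (pderiv l (F i)) = 0 := fun i => by
      have := congrArg (eval x) (hF i).sum_X_mul_pderiv
      simpa [hxF i] using this
    have hnone : v none = 0 := by
      have h2 : ∑ l, x l * (v none * eval x (pderiv l (G none)) +
          ∑ i, v (some i) * eval x (pderiv l (G (some i)))) = 0 :=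
        Finset.sum_eq_zero fun l _ => by rw [hv l, mul_zero]
      simp only [mul_add, Finset.sum_add_distrib, Finset.mul_sum] at h2
      rw [Finset.sum_comm (s := Finset.univ) (t := (Finset.univ : Finset (Fin c)))] at h2
      have h3 : ∀ i, ∑ l, x l * (v (some i) * eval x (pderiv l (G (some i)))) = 0 := fun i => by
        rw [← mul_zero (v (some i)), ← hEuler i, Finset.mul_sum]
        exact Finset.sum_congr rfl fun l _ => by simp only [G, Option.elim]; ring
      rw [Finset.sum_eq_zero fun i _ => h3 i, add_zero, Finset.sum_eq_single j] at h2
      · simpa [G, hxj] using h2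
      · intro l _ hl
        simp [G, pderiv_X_of_ne hl.symm]
      · simp
    have hsome := hJ x hx0 hxF (fun i => v (some i)) fun l => by
      have h2 := hv l
      rw [hnone, zero_mul, zero_add] at h2
      exact h2
    funext i
    cases i with
    | none => exact hnone
    | some i => exact congrFun hsome i
  rw [hspan] at h1
  exact ⟨h1, Algebra.FinitePresentation.quotient (IsNoetherian.noetherian _)⟩

/-- Krull's theorem bounds the height above, all `F i` vanishing at the origin. Below, a minimal
prime either has a nonzero zero, where the Jacobian bound applies, or contains the ideal of the
origin. -/
theorem IsNondegenerate.isSmoothCompleteIntersection {K : Type*} [Field K] [IsAlgClosed K]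
    {N c : ℕ} (hcN : c ≤ N + 1) {d : Fin c → ℕ} (hd : ∀ i, d i ≠ 0)
    {F : Fin c → MvPolynomial (Fin (N + 1)) K} (hF : ∀ i, (F i).IsHomogeneous (d i))
    (hJ : IsNondegenerate F) : IsSmoothCompleteIntersection d F := by
  classical
  refine ⟨hF, le_antisymm ?_ ?_, smooth_chartRing hF hJ⟩
  · have hle : Ideal.span (Set.range F) ≤ RingHom.ker (eval (0 : Fin (N + 1) → K)) := by
      refine Ideal.span_le.2 ?_
      rintro _ ⟨i, rfl⟩
      have := eval_smul_of_isHomogeneous (hF i) 0 0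
      rw [zero_smul, zero_pow (hd i), zero_mul] at this
      exact RingHom.mem_ker.2 this
    have hp : (RingHom.ker (eval (0 : Fin (N + 1) → K))).IsPrime := RingHom.ker_isPrime _
    obtain ⟨q, hq, -⟩ := Ideal.exists_minimalPrimes_le hle
    have h1 : Set.range F = ((Finset.univ.image F : Finset _) : Set _) := by simp
    refine (Ideal.height_mono hq.1.2).trans ?_
    rw [h1] at hq
    refine (Ideal.height_le_card_of_mem_minimalPrimes_span_finset hq).trans ?_
    exact_mod_cast Finset.card_image_le.trans (by simp)
  · rw [Ideal.height_eq_inf_minimalPrimes]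
    refine le_iInf₂ fun q hq => ?_
    have hqp : q.IsPrime := hq.1.1
    have hFq : ∀ i, F i ∈ q := fun i => hq.1.2 (Ideal.subset_span ⟨i, rfl⟩)
    by_cases hx : ∃ x ∈ zeroLocus K q, x ≠ 0
    · obtain ⟨x, hxq, hx⟩ := hx
      have h1 := card_le_height_of_jacobian F q hFq x (fun p hp => hxq p hp)
        (hJ x hx fun i => hxq _ (hFq i))
      simpa using h1
    · push Not at hx
      have h1 : vanishingIdeal K ({0} : Set (Fin (N + 1) → K)) ≤ q := by
        rw [← IsPrime.vanishingIdeal_zeroLocus (K := K) q]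
        exact vanishingIdeal_anti_mono fun x hxq => hx x hxq
      refine le_trans ?_ (card_le_height_of_vanishingIdeal_le q h1)
      simpa using (by exact_mod_cast hcN : (c : ℕ∞) ≤ ((N + 1 : ℕ) : ℕ∞))

/-! ### Existence of nondegenerate systems by a parameter count -/

/-- The value at `x` of the form `∑ A u v X_u ^ (n - 1) X_v`. -/
def formValue {R ν : Type*} [CommRing R] [Fintype ν] (n : ℕ) (A : ν → ν → R) (x : ν → R) : R :=
  ∑ u, ∑ v, A u v * (x u ^ (n - 1) * x v)

/-- The value at `x` of the `l`-th partial derivative of the form `∑ A u v X_u ^ (n - 1) X_v`. -/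
def formDeriv {R ν : Type*} [CommRing R] [Fintype ν] (n : ℕ) (A : ν → ν → R) (x : ν → R) (l : ν) :
    R :=
  ∑ v, A l v * ((n - 1 : ℕ) * x l ^ (n - 2) * x v) + ∑ u, A u l * x u ^ (n - 1)

/-- The form `∑ A u v X_u ^ (n - 1) X_v`. -/
noncomputable def form {K ν : Type*} [Field K] [Fintype ν] (n : ℕ) (A : ν → ν → K) :
    MvPolynomial ν K :=
  formValue n (fun u v => C (A u v)) X

theorem map_formValue {R S ν : Type*} [CommRing R] [CommRing S] [Fintype ν] (φ : R →+* S) (n : ℕ)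
    (A : ν → ν → R) (x : ν → R) :
    φ (formValue n A x) = formValue n (fun u v => φ (A u v)) (fun u => φ (x u)) := by
  simp [formValue]

theorem map_formDeriv {R S ν : Type*} [CommRing R] [CommRing S] [Fintype ν] (φ : R →+* S) (n : ℕ)
    (A : ν → ν → R) (x : ν → R) (l : ν) :
    φ (formDeriv n A x l) = formDeriv n (fun u v => φ (A u v)) (fun u => φ (x u)) l := by
  simp [formDeriv]

theorem eval_form {K ν : Type*} [Field K] [Fintype ν] (n : ℕ) (A : ν → ν → K) (x : ν → K) :
    eval x (form n A) = formValue n A x := by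
  rw [form, map_formValue]
  simp

theorem pderiv_form {K ν : Type*} [Field K] [Fintype ν] (n : ℕ) (A : ν → ν → K) (l : ν) :
    pderiv l (form n A) = formDeriv n (fun u v => C (A u v)) X l := by
  classical
  have h1 : ∀ u v, pderiv l (C (A u v) * (X u ^ (n - 1) * X v) : MvPolynomial ν K) =
      (if u = l then C (A u v) * (((n - 1 : ℕ) : MvPolynomial ν K) * X u ^ (n - 2) * X v) else 0) +
        (if v = l then C (A u v) * X u ^ (n - 1) else 0) := fun u v => by
    rw [pderiv_C_mul, pderiv_mul, pderiv_pow, pderiv_X, pderiv_X, Pi.single_apply, Pi.single_apply]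
    rw [Nat.sub_sub]
    split_ifs <;> ring
  simp only [form, formValue, map_sum, h1, Finset.sum_add_distrib, formDeriv]
  congr 1
  · rw [Finset.sum_comm]
    simp
  · simp

theorem eval_pderiv_form {K ν : Type*} [Field K] [Fintype ν] (n : ℕ) (A : ν → ν → K) (x : ν → K)
    (l : ν) : eval x (pderiv l (form n A)) = formDeriv n A x l := by
  rw [pderiv_form, map_formDeriv]
  simp

theorem isHomogeneous_form {K ν : Type*} [Field K] [Fintype ν] {n : ℕ} (hn : n ≠ 0)
    (A : ν → ν → K) : (form n A).IsHomogeneous n := by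
  refine IsHomogeneous.sum _ _ _ fun u _ => IsHomogeneous.sum _ _ _ fun v _ => ?_
  have h1 := (isHomogeneous_C ν (A u v)).mul
    (((isHomogeneous_X K u).pow (n - 1)).mul (isHomogeneous_X K v))
  convert h1 using 1
  omega

/-- More polynomials than the transcendence degree cannot be algebraically independent. -/
theorem exists_ne_zero_aeval_eq_zero {K σ τ : Type*} [Field K] [Fintype σ] [Fintype τ]
    (f : σ → MvPolynomial τ K) (h : Fintype.card τ < Fintype.card σ) :
    ∃ Q : MvPolynomial σ K, Q ≠ 0 ∧ aeval f Q = 0 := by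
  by_contra! hcon
  have h1 : AlgebraicIndependent K f := by
    rw [algebraicIndependent_iff]
    intro p hp
    by_contra hp0
    exact hcon p hp0 hp
  have h2 := h1.lift_cardinalMk_le_trdeg
  rw [MvPolynomial.trdeg_of_isDomain] at h2
  simp only [Cardinal.mk_fintype, Cardinal.lift_natCast, Nat.cast_le] at h2
  omega

/-- The coefficients that are determined by a singular point with `x j = 1` and a relation with
`w i₀ = 1` between the gradients. -/
def IsDetermined {ι ν : Type*} (i₀ : ι) (j : ν) (s : ι × ν × ν) : Prop :=
  s.2.1 = j ∧ (s.2.2 = j ∨ s.1 = i₀)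

open Classical in
/-- The coefficients of the forms with a given singular point `x`, relation `w` and undetermined
coefficients `A`. -/
noncomputable def solveCoeff {R ι ν : Type*} [CommRing R] [Fintype ι] [Fintype ν] (d : ι → ℕ)
    (i₀ : ι) (j : ν) (A : ι → ν → ν → R) (x : ν → R) (w : ι → R) (i : ι) (u v : ν) : R :=
  let B : ν → ν → R := fun u v => if i = i₀ ∧ u = j ∧ v ≠ j then
    -∑ k, w k * formDeriv (d k) (A k) x v else A i u v
  if u = j ∧ v = j then -formValue (d i) B x else B u v

theorem map_solveCoeff {R S ι ν : Type*} [CommRing R] [CommRing S] [Fintype ι] [Fintype ν]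
    (φ : R →+* S) (d : ι → ℕ) (i₀ : ι) (j : ν) (A : ι → ν → ν → R) (x : ν → R) (w : ι → R)
    (i : ι) (u v : ν) : φ (solveCoeff d i₀ j A x w i u v) =
      solveCoeff d i₀ j (fun i u v => φ (A i u v)) (fun u => φ (x u)) (fun k => φ (w k)) i u v := by
  simp only [solveCoeff, apply_ite φ, map_neg, map_formValue, map_sum, map_mul, map_formDeriv]

open Classical in
-- For `l ≠ j` and `x j = 1`, the coefficient `A i₀ j l` enters the relation in direction `l` with
-- factor `1`, and no `A i j j` enters it. So the relations give the `A i₀ j l`, and then the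
-- equations give the `A i j j`. No division occurs, whence validity in every characteristic.
theorem solveCoeff_eq {R ι ν : Type*} [CommRing R] [Fintype ι] [Fintype ν] (d : ι → ℕ)
    (i₀ : ι) (j : ν) (A : ι → ν → ν → R) (x : ν → R) (w : ι → R) (hx : x j = 1) (hw : w i₀ = 1)
    (hA : ∀ i, formValue (d i) (A i) x = 0)
    (hA' : ∀ l, l ≠ j → ∑ k, w k * formDeriv (d k) (A k) x l = 0) (i : ι) (u v : ν) :
    solveCoeff d i₀ j (fun i u v => if IsDetermined i₀ j (i, u, v) then 0 else A i u v) x w i u v =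
      A i u v := by
  have h1 : ∀ l, l ≠ j → ∀ k, formDeriv (d k)
      (fun u v => if IsDetermined i₀ j (k, u, v) then 0 else A k u v) x l =
      formDeriv (d k) (A k) x l - if k = i₀ then A k j l else 0 := fun l hl k => by
    simp only [formDeriv, IsDetermined, hl, false_and, if_false, false_or, add_sub_assoc]
    congr 1
    rw [eq_sub_iff_add_eq]
    by_cases hk : k = i₀
    · simp only [hk, and_true, if_true]
      rw [← Finset.add_sum_erase _ _ (Finset.mem_univ j),
        ← Finset.add_sum_erase _ _ (Finset.mem_univ j)]
      simp only [hx, one_pow, mul_one, if_true, zero_add]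
      rw [add_comm]
      congr 1
      refine Finset.sum_congr rfl fun u hu => ?_
      rw [if_neg (Finset.ne_of_mem_erase hu)]
    · simp [hk]
  have h2 : ∀ l, l ≠ j → -∑ k, w k * formDeriv (d k)
      (fun u v => if IsDetermined i₀ j (k, u, v) then 0 else A k u v) x l = A i₀ j l :=
    fun l hl => by
      simp only [h1 l hl, mul_sub, Finset.sum_sub_distrib, hA' l hl]
      simp [hw]
  let B : ν → ν → R := fun u v => if i = i₀ ∧ u = j ∧ v ≠ j then -∑ k, w k * formDeriv (d k)
    (fun u v => if IsDetermined i₀ j (k, u, v) then 0 else A k u v) x v else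
    if IsDetermined i₀ j (i, u, v) then 0 else A i u v
  have h3 : B = fun u v => if u = j ∧ v = j then 0 else A i u v := by
    funext u v
    by_cases hv : v = j
    · simp [B, hv, IsDetermined]
    · simp only [B, h2 v hv]
      by_cases hu : u = j
      · subst hu
        by_cases hi : i = i₀
        · subst hi
          simp [hv]
        · simp [hv, hi, IsDetermined]
      · simp [hu, IsDetermined]
  change (if u = j ∧ v = j then -formValue (d i) B x else B u v) = A i u v
  rw [h3]
  have h4 : formValue (d i) (A i) x =
      formValue (d i) (fun u v => if u = j ∧ v = j then 0 else A i u v) x + A i j j := by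
    have h5 : ∀ u v, A i u v * (x u ^ (d i - 1) * x v) =
        (if u = j ∧ v = j then 0 else A i u v) * (x u ^ (d i - 1) * x v) +
          if u = j then (if v = j then A i u v * (x u ^ (d i - 1) * x v) else 0) else 0 :=
      fun u v => by
        by_cases hu : u = j <;> by_cases hv : v = j <;> simp [hu, hv]
    simp only [formValue]
    rw [Finset.sum_congr rfl fun u _ => Finset.sum_congr rfl fun v _ => h5 u v]
    simp only [Finset.sum_add_distrib]
    congr 1
    rw [Finset.sum_comm]
    simp [hx]
  split_ifs with h
  · rw [h.1, h.2, neg_eq_iff_add_eq_zero, ← h4, hA]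
  · exact if_neg h

open Classical in
/-- Extension by zero of a family of coefficients. -/
noncomputable def extendCoeff {R ι ν : Type*} [CommRing R] (M : Finset (ι × ν × ν)) (a : M → R)
    (i : ι) (u v : ν) : R :=
  if h : (i, u, v) ∈ M then a ⟨(i, u, v), h⟩ else 0

/-- Parameter count: coefficients of singular systems of forms satisfy an algebraic relation. -/
theorem exists_relation {K ι ν : Type*} [Field K] [Fintype ι] [Fintype ν] (d : ι → ℕ) (i₀ : ι)
    (j : ν) (M : Finset (ι × ν × ν)) (hM : ∀ i, (i, j, j) ∈ M) (hM' : ∀ l, (i₀, j, l) ∈ M) :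
    ∃ Q : MvPolynomial M K, Q ≠ 0 ∧ ∀ (a : M → K) (x : ν → K) (w : ι → K), x j = 1 → w i₀ = 1 →
      (∀ i, formValue (d i) (extendCoeff M a i) x = 0) →
      (∀ l, l ≠ j → ∑ k, w k * formDeriv (d k) (extendCoeff M a k) x l = 0) → eval a Q = 0 := by
  classical
  -- Parameters: the free coefficients, the coordinates of `x` other than `x j`, and those of `w`
  -- other than `w i₀`.
  let τ := {s : M // ¬ IsDetermined i₀ j s.1} ⊕ ({l // l ≠ j} ⊕ {k // k ≠ i₀})
  have hτ : Fintype.card τ < Fintype.card M := by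
    -- The determined coefficients outnumber the coordinates of `x` and `w` by at least one.
    let e : {l // l ≠ j} ⊕ ι → {s : M // IsDetermined i₀ j s.1} :=
      Sum.elim (fun l => ⟨⟨(i₀, j, l.1), hM' _⟩, rfl, Or.inr rfl⟩)
        (fun i => ⟨⟨(i, j, j), hM _⟩, rfl, Or.inl rfl⟩)
    have he : Function.Injective e := by
      rintro (l | i) (l' | i') h
      · replace h := congrArg (fun s : {s : M // IsDetermined i₀ j s.1} => s.1.1) h
        simp only [e, Sum.elim_inl, Prod.mk.injEq, true_and] at h
        exact congrArg Sum.inl (Subtype.ext h)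
      · replace h := congrArg (fun s : {s : M // IsDetermined i₀ j s.1} => s.1.1) h
        simp only [e, Sum.elim_inl, Sum.elim_inr, Prod.mk.injEq, true_and] at h
        exact absurd h.2 l.2
      · replace h := congrArg (fun s : {s : M // IsDetermined i₀ j s.1} => s.1.1) h
        simp only [e, Sum.elim_inl, Sum.elim_inr, Prod.mk.injEq, true_and] at h
        exact absurd h.2.symm l'.2
      · replace h := congrArg (fun s : {s : M // IsDetermined i₀ j s.1} => s.1.1) h
        simp only [e, Sum.elim_inr, Prod.mk.injEq, and_true] at h
        exact congrArg Sum.inr h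
    have h1 := Fintype.card_le_of_injective e he
    have h2 : Fintype.card {k // k ≠ i₀} < Fintype.card ι :=
      Fintype.card_subtype_lt (x := i₀) (by simp)
    have h3 := Fintype.card_subtype_compl fun s : M => IsDetermined i₀ j s.1
    have h4 := Fintype.card_subtype_le fun s : M => IsDetermined i₀ j s.1
    simp only [τ, Fintype.card_sum] at h1 ⊢
    omega
  let A : ι → ν → ν → MvPolynomial τ K := fun i u v =>
    if h : (i, u, v) ∈ M ∧ ¬ IsDetermined i₀ j (i, u, v) then X (Sum.inl ⟨⟨(i, u, v), h.1⟩, h.2⟩)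
    else 0
  let y : ν → MvPolynomial τ K := fun l =>
    if h : l ≠ j then X (Sum.inr (Sum.inl ⟨l, h⟩)) else 1
  let z : ι → MvPolynomial τ K := fun k =>
    if h : k ≠ i₀ then X (Sum.inr (Sum.inr ⟨k, h⟩)) else 1
  obtain ⟨Q, hQ, hQ0⟩ := exists_ne_zero_aeval_eq_zero
    (fun s : M => solveCoeff d i₀ j A y z s.1.1 s.1.2.1 s.1.2.2) hτ
  refine ⟨Q, hQ, fun a x w hx hw ha ha' => ?_⟩
  let t : τ → K := Sum.elim (fun s => a s.1) (Sum.elim (fun l => x l.1) fun k => w k.1)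
  have hy : (fun l => eval t (y l)) = x := funext fun l => by
    by_cases hl : l = j
    · simp [y, hl, hx]
    · simp [y, hl, t]
  have hz : (fun k => eval t (z k)) = w := funext fun k => by
    by_cases hk : k = i₀
    · simp [z, hk, hw]
    · simp [z, hk, t]
  have hA : (fun i u v => eval t (A i u v)) = fun i u v =>
      if IsDetermined i₀ j (i, u, v) then 0 else extendCoeff M a i u v := by
    funext i u v
    by_cases h1 : IsDetermined i₀ j (i, u, v)
    · simp [A, h1]
    · by_cases h2 : (i, u, v) ∈ M
      · simp [A, h1, h2, extendCoeff, t]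
      · simp [A, h1, h2, extendCoeff]
  have h1 : a = fun s => eval t (solveCoeff d i₀ j A y z s.1.1 s.1.2.1 s.1.2.2) := funext fun s => by
    rw [map_solveCoeff, hy, hz, hA, solveCoeff_eq d i₀ j _ x w hx hw ha ha']
    simp [extendCoeff]
  have h2 := congrArg (eval t) hQ0
  rw [map_zero] at h2
  rw [h1, ← h2, aeval_def, eval₂_eq', eval_eq', map_sum]
  simp [algebraMap_eq]

theorem sum_eq_sum_subtype {R ν : Type*} [AddCommMonoid R] [Fintype ν] (p : ν → Prop)
    [DecidablePred p] (f : ν → R) (hf : ∀ u, ¬ p u → f u = 0) : ∑ u, f u = ∑ u : {u // p u}, f u := by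
  have h1 : ∑ u : {u // ¬ p u}, f u = 0 := Finset.sum_eq_zero fun u _ => hf u.1 u.2
  rw [← Fintype.sum_subtype_add_sum_subtype p f, h1, add_zero]

theorem formValue_eq_subtype {R ν : Type*} [CommRing R] [Fintype ν] (p : ν → Prop)
    [DecidablePred p] (n : ℕ) (A : ν → ν → R) (x : ν → R) (hA : ∀ u v, ¬ (p u ∧ p v) → A u v = 0) :
    formValue n A x = formValue n (fun u v : {u // p u} => A u v) fun u => x u := by
  rw [formValue, sum_eq_sum_subtype p _ fun u hu => Finset.sum_eq_zero fun v _ => by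
    rw [hA u v fun h => hu h.1, zero_mul]]
  refine Finset.sum_congr rfl fun u _ => ?_
  exact sum_eq_sum_subtype p _ fun v hv => by rw [hA u v fun h => hv h.2, zero_mul]

theorem formDeriv_eq_subtype {R ν : Type*} [CommRing R] [Fintype ν] (p : ν → Prop)
    [DecidablePred p] (n : ℕ) (A : ν → ν → R) (x : ν → R) (hA : ∀ u v, ¬ (p u ∧ p v) → A u v = 0)
    (l : {u // p u}) :
    formDeriv n A x l = formDeriv n (fun u v : {u // p u} => A u v) (fun u => x u) l := by
  rw [formDeriv, sum_eq_sum_subtype p _ fun v hv => by rw [hA l v fun h => hv h.2, zero_mul],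
    sum_eq_sum_subtype p _ fun u hu => by rw [hA u l fun h => hu h.1, zero_mul]]
  rfl

/-- The coefficients of systems of forms all of which but the `i₀`-th do not involve the variable
`z`. -/
def coeffIndex {ι ν : Type*} [Fintype ι] [Fintype ν] [DecidableEq ι] [DecidableEq ν] (i₀ : ι)
    (z : ν) : Finset (ι × ν × ν) :=
  Finset.univ.filter fun s => s.1 = i₀ ∨ (s.2.1 ≠ z ∧ s.2.2 ≠ z)

theorem extendCoeff_coeffIndex_eq_zero {R ι ν : Type*} [CommRing R] [Fintype ι] [Fintype ν]
    [DecidableEq ι] [DecidableEq ν] {i₀ : ι} {z : ν} (a : coeffIndex i₀ z → R) {i : ι}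
    (hi : i ≠ i₀) (u v : ν) (h : ¬ (u ≠ z ∧ v ≠ z)) : extendCoeff (coeffIndex i₀ z) a i u v = 0 := by
  rw [extendCoeff, dif_neg]
  simp only [coeffIndex, Finset.mem_filter, Finset.mem_univ, true_and, hi, false_or]
  exact h

/-- When `w i₀ = 0`, the relation concerns only the forms free of `z`, so the count is made for
them, in the variables other than `z`. -/
theorem exists_relation_of_ne {K ι ν : Type*} [Field K] [Fintype ι] [Fintype ν]
    [DecidableEq ι] [DecidableEq ν] (d : ι → ℕ) {i₀ i₁ : ι} {j z : ν} (hi : i₁ ≠ i₀) (hj : j ≠ z) :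
    ∃ Q : MvPolynomial (coeffIndex i₀ z) K, Q ≠ 0 ∧
      ∀ (a : coeffIndex i₀ z → K) (x : ν → K) (w : ι → K), x j = 1 → w i₁ = 1 → w i₀ = 0 →
      (∀ i, formValue (d i) (extendCoeff _ a i) x = 0) →
      (∀ l, ∑ k, w k * formDeriv (d k) (extendCoeff _ a k) x l = 0) → eval a Q = 0 := by
  classical
  obtain ⟨Q, hQ, hQ0⟩ := exists_relation (K := K) (fun i : {i // i ≠ i₀} => d i) ⟨i₁, hi⟩
    (⟨j, hj⟩ : {v // v ≠ z}) Finset.univ (fun _ => Finset.mem_univ _) (fun _ => Finset.mem_univ _)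
  let g : ((Finset.univ : Finset ({i // i ≠ i₀} × {v // v ≠ z} × {v // v ≠ z})) : Type _) →
      coeffIndex i₀ z := fun s => ⟨(s.1.1.1, s.1.2.1.1, s.1.2.2.1), by
    simp only [coeffIndex, Finset.mem_filter, Finset.mem_univ, true_and]
    exact Or.inr ⟨s.1.2.1.2, s.1.2.2.2⟩⟩
  have hg : Function.Injective g := by
    rintro ⟨⟨⟨a, _⟩, ⟨b, _⟩, ⟨e, _⟩⟩, _⟩ ⟨⟨⟨a', _⟩, ⟨b', _⟩, ⟨e', _⟩⟩, _⟩ h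
    simpa [g] using h
  refine ⟨rename g Q, (rename_injective g hg).ne_iff' (map_zero _) |>.2 hQ,
    fun a x w hx hw hw₀ ha ha' => ?_⟩
  have hext : ∀ i : {i // i ≠ i₀}, extendCoeff Finset.univ (a ∘ g) i =
      fun u v => extendCoeff (coeffIndex i₀ z) a i.1 u.1 v.1 := fun i => by
    funext u v
    have h1 : (i.1, u.1, v.1) ∈ coeffIndex i₀ z := by
      simp only [coeffIndex, Finset.mem_filter, Finset.mem_univ, true_and]
      exact Or.inr ⟨u.2, v.2⟩
    rw [extendCoeff, extendCoeff, dif_pos h1, dif_pos (Finset.mem_univ _)]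
    rfl
  rw [eval_rename]
  refine hQ0 (a ∘ g) (fun u => x u) (fun k => w k) hx hw (fun i => ?_) fun l _ => ?_
  · rw [hext, ← formValue_eq_subtype (fun v => v ≠ z) _ _ _
      (fun u v => extendCoeff_coeffIndex_eq_zero a i.2 u v)]
    exact ha i
  · rw [← ha' l, sum_eq_sum_subtype (fun k => k ≠ i₀) _ fun k hk => by
      rw [not_not.1 hk, hw₀, zero_mul]]
    refine Finset.sum_congr rfl fun k _ => ?_
    rw [hext, ← formDeriv_eq_subtype (fun v => v ≠ z) _ _ _
      (fun u v => extendCoeff_coeffIndex_eq_zero a k.2 u v)]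

/-- Coefficients are chosen off the zero set of a nonzero product: the coefficient at `(i₀, z, z)`,
the relations `Q₁` for gradient relations involving `F i₀`, and `Q₂` for the others. -/
theorem exists_isNondegenerate {K ι ν : Type*} [Field K] [Infinite K] [Fintype ι] [Fintype ν]
    (d : ι → ℕ) (hd : ∀ i, 2 ≤ d i) (i₀ : ι) (z : ν) :
    ∃ A : ι → ν → ν → K, (∀ i, i ≠ i₀ → ∀ u v, ¬ (u ≠ z ∧ v ≠ z) → A i u v = 0) ∧
      A i₀ z z ≠ 0 ∧ IsNondegenerate fun i => form (d i) (A i) := by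
  classical
  have hmem : ∀ u v, (i₀, u, v) ∈ coeffIndex i₀ z := fun u v => by simp [coeffIndex]
  choose Q₁ hQ₁ hQ₁' using fun j : {j // j ≠ z} => exists_relation (K := K) d i₀ j.1
    (coeffIndex i₀ z) (fun i => by simp [coeffIndex, j.2]) (fun l => hmem _ _)
  choose Q₂ hQ₂ hQ₂' using fun (j : {j // j ≠ z}) (i : {i // i ≠ i₀}) =>
    exists_relation_of_ne (K := K) d i.2 j.2
  obtain ⟨a, ha⟩ : ∃ a, eval a (X ⟨(i₀, z, z), hmem z z⟩ * ((∏ j, Q₁ j) * ∏ j, ∏ i, Q₂ j i)) ≠ 0 := by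
    by_contra! hcon
    have h1 := MvPolynomial.funext fun a => (hcon a).trans (map_zero (eval a)).symm
    refine mul_ne_zero (X_ne_zero _) (mul_ne_zero ?_ ?_) h1
    · exact Finset.prod_ne_zero_iff.2 fun j _ => hQ₁ j
    · exact Finset.prod_ne_zero_iff.2 fun j _ => Finset.prod_ne_zero_iff.2 fun i _ => hQ₂ j i
  simp only [map_mul, map_prod, eval_X, mul_ne_zero_iff, Finset.prod_ne_zero_iff] at ha
  obtain ⟨ha, ha₁, ha₂⟩ := ha
  refine ⟨extendCoeff _ a, fun i hi => extendCoeff_coeffIndex_eq_zero a hi, ?_,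
    isNondegenerate_of_chart (fun i => isHomogeneous_form (by have := hd i; omega) _)
      fun x hx hxF => ?_⟩
  · rw [extendCoeff, dif_pos (hmem z z)]
    exact ha
  -- The chart of `z` is not needed: on the `z`-axis the `i₀`-th form is a nonzero multiple of `x z
  -- ^ d i₀`.
  obtain ⟨j, hjz, hj⟩ : ∃ j, j ≠ z ∧ x j ≠ 0 := by
    by_contra! hcon
    have hz : x z ≠ 0 := fun hz => hx <| funext fun u => by
      by_cases hu : u = z
      · rw [hu, hz]; rfl
      · exact hcon u hu
    have h1 := hxF i₀
    have h2 : d i₀ - 1 ≠ 0 := by have := hd i₀; omega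
    rw [eval_form, formValue, Finset.sum_eq_single z, Finset.sum_eq_single z] at h1
    · rw [extendCoeff, dif_pos (hmem z z)] at h1
      exact mul_ne_zero ha (mul_ne_zero (pow_ne_zero _ hz) hz) h1
    · intro v _ hv
      rw [hcon v hv, mul_zero, mul_zero]
    · simp
    · intro u _ hu
      refine Finset.sum_eq_zero fun v _ => ?_
      rw [hcon u hu, zero_pow h2, zero_mul, mul_zero]
    · simp
  refine ⟨j, hj, fun y hy hyF v hv => ?_⟩
  simp only [eval_form, eval_pderiv_form] at hyF hv
  by_contra hne
  have hscale : ∀ k l, ∑ i, ((v k)⁻¹ * v i) * formDeriv (d i) (extendCoeff _ a i) y l = 0 :=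
    fun k l => by
      simp only [mul_assoc]
      rw [← Finset.mul_sum, hv l, mul_zero]
  by_cases h0 : v i₀ = 0
  · obtain ⟨i, hi⟩ := Function.ne_iff.1 hne
    have hi₀ : i ≠ i₀ := fun h => hi (h ▸ h0)
    exact ha₂ ⟨j, hjz⟩ (Finset.mem_univ _) ⟨i, hi₀⟩ (Finset.mem_univ _)
      (hQ₂' ⟨j, hjz⟩ ⟨i, hi₀⟩ a y (fun k => (v i)⁻¹ * v k) hy (inv_mul_cancel₀ hi)
        (by simp [h0]) hyF (hscale i))
  · exact ha₁ ⟨j, hjz⟩ (Finset.mem_univ _) (hQ₁' ⟨j, hjz⟩ a y (fun k => (v i₀)⁻¹ * v k) hy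
      (inv_mul_cancel₀ h0) hyF fun l _ => hscale i₀ l)

/-! ### The extremal weight and optimality -/

/-- The weight `(-1, …, -1, N)`. -/
def lastWeight (N : ℕ) (i : Fin (N + 1)) : ℤ :=
  if i = Fin.last N then N else -1

theorem isWeight_lastWeight {N : ℕ} (hN : N ≠ 0) : IsWeight (lastWeight N) := by
  refine ⟨fun i j hij => ?_, ⟨Fin.last N, by simpa [lastWeight] using hN⟩, ?_⟩
  · by_cases hj : j = Fin.last N
    · simp only [lastWeight, hj, if_true]
      split_ifs <;> omega
    · have hi : i ≠ Fin.last N := fun hi => hj (Fin.last_le_iff.1 (hi ▸ hij))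
      simp [lastWeight, hi, hj]
  · simp [Fin.sum_univ_castSucc, lastWeight]

theorem weight_lastWeight {N : ℕ} (m : Fin (N + 1) →₀ ℕ) :
    Finsupp.weight (lastWeight N) m = (N + 1) * m (Fin.last N) - m.degree := by
  rw [Finsupp.weight_apply, Finsupp.sum_fintype _ _ (by simp), Finsupp.degree_eq_sum,
    Fin.sum_univ_castSucc, Fin.sum_univ_castSucc]
  simp [lastWeight]
  ring

theorem degree_eq_of_mem_support {K ν : Type*} [CommSemiring K] {n : ℕ} {F : MvPolynomial ν K}
    (hF : F.IsHomogeneous n) {m : ν →₀ ℕ} (hm : m ∈ F.support) : m.degree = n := by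
  rw [Finsupp.degree_eq_weight_one]
  exact hF (mem_support_iff.1 hm)

theorem form_mem_supported {K ν : Type*} [Field K] [Fintype ν] (n : ℕ) {A : ν → ν → K} {z : ν}
    (hA : ∀ u v, ¬ (u ≠ z ∧ v ≠ z) → A u v = 0) : form n A ∈ supported K {v | v ≠ z} := by
  refine Subalgebra.sum_mem _ fun u _ => Subalgebra.sum_mem _ fun v _ => ?_
  by_cases h : u ≠ z ∧ v ≠ z
  · exact Subalgebra.mul_mem _ (Subalgebra.algebraMap_mem _ _) (Subalgebra.mul_mem _
      (Subalgebra.pow_mem _ (X_mem_supported.2 h.1) _) (X_mem_supported.2 h.2))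
  · simp only [hA u v h, C_0, zero_mul]
    exact Subalgebra.zero_mem _

theorem alphaDeg_lastWeight_of_mem_supported {K : Type*} [Field K] {N n : ℕ}
    {F : MvPolynomial (Fin (N + 1)) K} (hF : F.IsHomogeneous n) (hF0 : F ≠ 0)
    (h : F ∈ supported K {v | v ≠ Fin.last N}) : alphaDeg (lastWeight N) F = -n := by
  have h1 : ∀ m ∈ F.support, Finsupp.weight (lastWeight N) m = -n := fun m hm => by
    have h2 : m (Fin.last N) = 0 := by
      by_contra h3
      exact mem_supported.1 h
        ((mem_vars_iff_mem_support _).2 ⟨m, hm, Finsupp.mem_support_iff.2 h3⟩) rfl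
    rw [weight_lastWeight, h2, degree_eq_of_mem_support hF hm]
    simp
  obtain ⟨m, hm⟩ := support_nonempty.2 hF0
  exact le_antisymm (alphaDeg_le _ hF0 fun m hm => (h1 m hm).le)
    ((h1 m hm).ge.trans (weight_le_alphaDeg _ hm))

theorem alphaDeg_lastWeight_form {K : Type*} [Field K] {N n : ℕ} (hn : 2 ≤ n)
    {A : Fin (N + 1) → Fin (N + 1) → K} (hA : A (Fin.last N) (Fin.last N) ≠ 0) :
    alphaDeg (lastWeight N) (form n A) = N * n := by
  have hF := isHomogeneous_form (by omega : n ≠ 0) A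
  have h1 : eval (Pi.single (Fin.last N) 1) (form n A) ≠ 0 := by
    rw [eval_form, formValue, Finset.sum_eq_single (Fin.last N), Finset.sum_eq_single (Fin.last N)]
    · simpa using hA
    · intro v _ hv
      simp [hv]
    · simp
    · intro u _ hu
      simp [hu, zero_pow (by omega : n - 1 ≠ 0)]
    · simp
  have h0 : form n A ≠ 0 := fun h => h1 (by rw [h, map_zero])
  refine le_antisymm (alphaDeg_le _ h0 fun m hm => ?_) ?_
  · have h2 : m (Fin.last N) ≤ m.degree := Finsupp.le_degree _ _
    rw [degree_eq_of_mem_support hF hm] at h2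
    rw [weight_lastWeight, degree_eq_of_mem_support hF hm]
    have h3 : (m (Fin.last N) : ℤ) ≤ n := by exact_mod_cast h2
    nlinarith
  · by_contra! h2
    -- A smaller degree would make the form vanish on the last coordinate axis.
    refine h1 (eval_eq_zero_of_alphaDeg_lt (lastWeight N) hF (t := N) ?_ fun i hi => ?_)
    · have h3 : (alphaDeg (lastWeight N) (form n A) : ℝ) < ((N * n : ℤ) : ℝ) := Int.cast_lt.2 h2
      push_cast at h3
      linarith
    · have h3 : i ≠ Fin.last N := by
        rintro rfl
        simp [lastWeight] at hi
      simp [h3]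

theorem exists_weightedDegSum_eq {K : Type*} [Field K] [IsAlgClosed K] {N c : ℕ} (hc : 1 ≤ c)
    (hcN : c ≤ N) {d : Fin c → ℕ} (hd : ∀ i, 2 ≤ d i) (i₀ : Fin c) :
    ∃ (α : Fin (N + 1) → ℤ) (F : Fin c → MvPolynomial (Fin (N + 1)) K),
      IsWeight α ∧ IsSmoothCompleteIntersection d F ∧
        ∀ k : Fin c → ℝ, weightedDegSum d k α F = (N + 1) * k i₀ - ∑ j, k j := by
  classical
  have hd0 : ∀ i, d i ≠ 0 := fun i => by have := hd i; omega
  obtain ⟨A, hA, hA₀, hJ⟩ := exists_isNondegenerate (K := K) d hd i₀ (Fin.last N)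
  have hF : IsSmoothCompleteIntersection d fun i => form (d i) (A i) :=
    hJ.isSmoothCompleteIntersection (by omega) hd0 fun i => isHomogeneous_form (hd0 i) _
  refine ⟨lastWeight N, _, isWeight_lastWeight (by omega), hF, fun k => ?_⟩
  have h1 : ∀ j, (alphaDeg (lastWeight N) (form (d j) (A j)) : ℝ) / d j =
      if j = i₀ then (N : ℝ) else -1 := fun j => by
    have h2 : (d j : ℝ) ≠ 0 := by exact_mod_cast hd0 j
    split_ifs with hj
    · subst hj
      rw [alphaDeg_lastWeight_form (hd j) hA₀]
      push_cast
      field_simp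
    · rw [alphaDeg_lastWeight_of_mem_supported (hF.isHomogeneous j) (hF.ne_zero j)
        (form_mem_supported _ (hA j hj))]
      push_cast
      field_simp
  simp only [weightedDegSum, h1]
  rw [← Finset.add_sum_erase _ _ (Finset.mem_univ i₀), ← Finset.add_sum_erase _ k
    (Finset.mem_univ i₀), if_pos rfl, Finset.sum_congr rfl fun j hj => by
      rw [if_neg (Finset.ne_of_mem_erase hj), mul_neg_one], Finset.sum_neg_distrib]
  ring

/-! ### The quadric that makes the excluded case necessary -/

open Classical in
/-- The coefficients of the quadric `∑ X_u X_{N - u}`, the sum being over `u ≤ N - u`. -/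
noncomputable def quadricCoeff (K : Type*) [Field K] (N : ℕ) (u v : Fin (N + 1)) : K :=
  if v = u.rev ∧ u ≤ v then 1 else 0

/-- A vanishing gradient kills every coordinate except possibly the middle one, whose derivative is
zero in characteristic two. The equation itself then kills that coordinate, as its square occurs
with coefficient `1`. -/
theorem isNondegenerate_quadric {K : Type*} [Field K] (N : ℕ) :
    IsNondegenerate fun _ : Fin 1 => form 2 (quadricCoeff K N) := by
  classical
  intro x hx hF v hv
  have hD : ∀ l, formDeriv 2 (quadricCoeff K N) x l =
      (if l ≤ l.rev then x l.rev else 0) + if l.rev ≤ l then x l.rev else 0 := fun l => by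
    rw [formDeriv, Finset.sum_eq_single l.rev, Finset.sum_eq_single l.rev]
    · simp [quadricCoeff]
    · intro u _ hu
      rw [quadricCoeff, if_neg, zero_mul]
      rintro ⟨rfl, -⟩
      simp at hu
    · simp
    · intro u _ hu
      simp [quadricCoeff, hu]
    · simp
  by_contra hne
  have h0 : v 0 ≠ 0 := fun h => hne <| funext fun i => by rw [Subsingleton.elim i 0, h]; rfl
  have h1 : ∀ m, m ≠ m.rev → x m = 0 := fun m hm => by
    have h2 := hv m.rev
    simp only [Fin.sum_univ_one, eval_pderiv_form, hD, mul_eq_zero, h0, false_or, Fin.rev_rev] at h2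
    rcases lt_or_gt_of_ne hm with h | h
    · simpa [h.le, h.not_ge] using h2
    · simpa [h.le, h.not_ge] using h2
  obtain ⟨j, hj⟩ := Function.ne_iff.1 hx
  have hjr : j = j.rev := by
    by_contra h
    exact hj (h1 j h)
  have h2 := hF 0
  rw [eval_form, formValue, Finset.sum_eq_single j, Finset.sum_eq_single j] at h2
  · have h3 : x j = 0 := by simpa [quadricCoeff, ← hjr] using h2
    exact hj h3
  · intro u _ hu
    rw [quadricCoeff, if_neg, zero_mul]
    rintro ⟨h, -⟩
    exact hu (h.trans hjr.symm)
  · simp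
  · intro u _ hu
    have h3 : x u = 0 := h1 u fun h => hu <| Fin.ext <| by
      have h4 := congrArg Fin.val h
      have h5 := congrArg Fin.val hjr
      rw [Fin.val_rev] at h4 h5
      omega
    simp [h3]
  · simp

theorem exists_quadric_weightedDegSum_eq_zero (K : Type*) [Field K] [IsAlgClosed K] {N : ℕ}
    (hN : 1 ≤ N) {d : Fin 1 → ℕ} (hd : d 0 = 2) :
    ∃ (α : Fin (N + 1) → ℤ) (F : Fin 1 → MvPolynomial (Fin (N + 1)) K),
      IsWeight α ∧ IsSmoothCompleteIntersection d F ∧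
        ∀ k : Fin 1 → ℝ, weightedDegSum d k α F = 0 := by
  classical
  obtain rfl : d = fun _ => 2 := funext fun i => by rw [Subsingleton.elim i 0, hd]
  have hF := (isNondegenerate_quadric (K := K) N).isSmoothCompleteIntersection (by omega)
    (fun _ => two_ne_zero) fun _ => isHomogeneous_form two_ne_zero _
  -- This weight is antisymmetric under `Fin.rev`, so each monomial `X_u X_{N - u}` has weight zero.
  let α : Fin (N + 1) → ℤ := fun i => 2 * i - N
  refine ⟨α, _, ⟨fun i j hij => ?_, ⟨0, ?_⟩, ?_⟩, hF, fun k => ?_⟩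
  · have : (i : ℤ) ≤ j := by exact_mod_cast hij
    simp only [α]
    omega
  · simp only [α, Fin.val_zero]
    omega
  · have h1 : ∑ i, α i = ∑ i, α (Fin.rev i) := (Equiv.sum_comp Fin.revPerm α).symm
    have h2 : ∀ i : Fin (N + 1), α i.rev = -α i := fun i => by
      have := i.is_le
      simp only [α, Fin.val_rev]
      omega
    simp only [h2, Finset.sum_neg_distrib] at h1
    omega
  · have h1 : IsWeightedHomogeneous α (form 2 (quadricCoeff K N)) 0 := by
      refine IsWeightedHomogeneous.sum _ _ _ fun u _ => IsWeightedHomogeneous.sum _ _ _ fun v _ => ?_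
      by_cases h : v = u.rev
      · have h2 := (isWeightedHomogeneous_C α (quadricCoeff K N u v)).mul
          (((isWeightedHomogeneous_X K α u).pow 1).mul (isWeightedHomogeneous_X K α v))
        convert h2 using 1
        subst h
        have := u.is_le
        simp only [α, Fin.val_rev]
        simp
        omega
      · have h2 : quadricCoeff K N u v = 0 := if_neg fun h' => h h'.1
        simp only [h2, C_0, zero_mul]
        exact isWeightedHomogeneous_zero K α 0
    have h2 : alphaDeg α (form 2 (quadricCoeff K N)) = 0 := by
      have h3 := hF.ne_zero 0
      obtain ⟨m, hm⟩ := support_nonempty.2 h3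
      exact le_antisymm (alphaDeg_le _ h3 fun m hm => (h1 (mem_support_iff.1 hm)).le)
        ((h1 (mem_support_iff.1 hm)).ge.trans (weight_le_alphaDeg _ hm))
    simp [weightedDegSum, h2]

end AlphaDegree

theorem mainTheorem6 {K : Type*} [Field K] [IsAlgClosed K] (N c : ℕ) (hc : 1 ≤ c) (hcN : c ≤ N)
    (d : Fin c → ℕ) (hd : ∀ i, 2 ≤ d i) (hmono : Monotone d) :
    -- (i)
    (∀ k : Fin c → ℝ, (∀ i, (∑ j, k j) / ((N : ℝ) + 1) ≤ k i) →
      ∀ (α : Fin (N + 1) → ℤ) (F : Fin c → MvPolynomial (Fin (N + 1)) K),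
        AlphaDegree.IsWeight α → AlphaDegree.IsSmoothCompleteIntersection d F →
          0 ≤ AlphaDegree.weightedDegSum d k α F) ∧
    -- (ii)
    (¬ (c = 1 ∧ d ⟨0, hc⟩ = 2) →
      ∀ k : Fin c → ℝ, (∀ i, (∑ j, k j) / ((N : ℝ) + 1) < k i) →
        ∀ (α : Fin (N + 1) → ℤ) (F : Fin c → MvPolynomial (Fin (N + 1)) K),
          AlphaDegree.IsWeight α → AlphaDegree.IsSmoothCompleteIntersection d F →
            0 < AlphaDegree.weightedDegSum d k α F) ∧
    -- (iii), optimality of (i)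
    (∀ k : Fin c → ℝ, ¬ (∀ i, (∑ j, k j) / ((N : ℝ) + 1) ≤ k i) →
      ∃ (α : Fin (N + 1) → ℤ) (F : Fin c → MvPolynomial (Fin (N + 1)) K),
        AlphaDegree.IsWeight α ∧ AlphaDegree.IsSmoothCompleteIntersection d F ∧
          ¬ 0 ≤ AlphaDegree.weightedDegSum d k α F) ∧
    -- (iii), optimality of (ii)
    (∀ k : Fin c → ℝ, ¬ (∀ i, (∑ j, k j) / ((N : ℝ) + 1) < k i) →
      ∃ (α : Fin (N + 1) → ℤ) (F : Fin c → MvPolynomial (Fin (N + 1)) K),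
        AlphaDegree.IsWeight α ∧ AlphaDegree.IsSmoothCompleteIntersection d F ∧
          ¬ 0 < AlphaDegree.weightedDegSum d k α F) ∧
    -- (iii), the case excluded in (ii) has to be excluded
    (c = 1 ∧ d ⟨0, hc⟩ = 2 →
      ∀ k : Fin c → ℝ,
        ∃ (α : Fin (N + 1) → ℤ) (F : Fin c → MvPolynomial (Fin (N + 1)) K),
          AlphaDegree.IsWeight α ∧ AlphaDegree.IsSmoothCompleteIntersection d F ∧
            ¬ 0 < AlphaDegree.weightedDegSum d k α F) := by
  refine ⟨fun k hk α F hα hF => AlphaDegree.weightedDegSum_nonneg hc hcN hd hk hα hF,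
    fun hcd k hk α F hα hF => AlphaDegree.weightedDegSum_pos hc hcN hd hcd hk hα hF,
    fun k hk => ?_, fun k hk => ?_, ?_⟩
  · push Not at hk
    obtain ⟨i, hi⟩ := hk
    obtain ⟨α, F, hα, hF, h⟩ := AlphaDegree.exists_weightedDegSum_eq (K := K) hc hcN hd i
    refine ⟨α, F, hα, hF, ?_⟩
    rw [lt_div_iff₀ (by positivity)] at hi
    rw [h]
    linarith
  · push Not at hk
    obtain ⟨i, hi⟩ := hk
    obtain ⟨α, F, hα, hF, h⟩ := AlphaDegree.exists_weightedDegSum_eq (K := K) hc hcN hd i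
    refine ⟨α, F, hα, hF, ?_⟩
    rw [le_div_iff₀ (by positivity)] at hi
    rw [h]
    linarith
  · rintro ⟨rfl, hd2⟩ k
    obtain ⟨α, F, hα, hF, h⟩ :=
      AlphaDegree.exists_quadric_weightedDegSum_eq_zero K hcN hd2
    exact ⟨α, F, hα, hF, by rw [h]; exact lt_irrefl 0⟩
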